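/- Let $N\in\mathbb N$, $0<s<1<p<N$, $\theta\in[s,1]$, and let $\Omega\subseteq\mathbb R^N$ be open. Let $$X(\Omega)=\{u\in W^{1,p}(\mathbb R^N): u|_\Omega\in W^{1,p}_0(\Omega),\ u=0 \text{ a.e. in } \mathbb R^N\setminus\Omega\},$$ where functions are real-valued and $W^{1,p}_0(\Omega)$ is the closure of $C_c^\infty(\Omega)$ in $W^{1,p}(\Omega)$. Put $C_H=\left(\frac{N-p}{p}\right)^p$ and $$C_{N,p,s}=2\int_0^1 r^{ps-1}\left|1-r^{(N-ps)/p}\right|^p\Psi_{N,s,p}(r)\,dr,\qquad \Psi_{N,s,p}(r)=|\mathbb S^{N-2}|\int_{-1}^1\frac{(1-t^2)^{(N-3)/2}}{(1-2rt+r^2)^{(N+ps)/2}}\,dt,$$ where $|\mathbb S^{N-2}|$ is the surface measure of the unit sphere of $\mathbb R^{N-1}$ (note $N\ge 2$; $|\mathbb S^0|=2$). Then for every $u\in X(\Omega)$, with weak gradient $\nabla u$, $$\int_\Omega\frac{|u|^p}{|x|^{p\theta}}\,dx\le\frac{\theta-s}{(1-s)\,C_H}\int_\Omega|\nabla u|^p\,dx+\frac{1-\theta}{(1-s)\,C_{N,p,s}}\int_{\mathbb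 R^N}\int_{\mathbb R^N}\frac{|u(x)-u(y)|^p}{|x-y|^{N+sp}}\,dy\,dx .$$ -/

import Mathlib

open MeasureTheory Set
open scoped ContDiff ENNReal

namespace MixedHardy

/-- The Euclidean space `ℝ^N`. -/
abbrev Eucl (N : ℕ) : Type := EuclideanSpace ℝ (Fin N)

/-- `φ ∈ C_c^∞(Ω)`: smooth, with compact support contained in `Ω`. -/
def IsTestFunction {N : ℕ} (Ω : Set (Eucl N)) (φ : Eucl N → ℝ) : Prop :=
  ContDiff ℝ ∞ φ ∧ HasCompactSupport φ ∧ tsupport φ ⊆ Ω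

/-- `g` is the weak (distributional) gradient of `u` on the open set `Ω`. -/
def IsWeakGradient {N : ℕ} (Ω : Set (Eucl N)) (u : Eucl N → ℝ) (g : Eucl N → Eucl N) : Prop :=
  LocallyIntegrableOn u Ω ∧ LocallyIntegrableOn g Ω ∧
    ∀ φ : Eucl N → ℝ, IsTestFunction Ω φ →
      ∫ x in Ω, u x • gradient φ x = -∫ x in Ω, φ x • g x

/-- `u ∈ W^{1,p}(Ω)`. -/
def MemW1p {N : ℕ} (Ω : Set (Eucl N)) (p : ℝ) (u : Eucl N → ℝ) : Prop :=
  MemLp u (ENNReal.ofReal p) (volume.restrict Ω) ∧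
    ∃ g : Eucl N → Eucl N, IsWeakGradient Ω u g ∧
      MemLp g (ENNReal.ofReal p) (volume.restrict Ω)

/-- `u ∈ W_0^{1,p}(Ω)`: `u` belongs to the closure of `C_c^∞(Ω)` in `W^{1,p}(Ω)`. -/
def MemW1p0 {N : ℕ} (Ω : Set (Eucl N)) (p : ℝ) (u : Eucl N → ℝ) : Prop :=
  MemLp u (ENNReal.ofReal p) (volume.restrict Ω) ∧
    ∃ g : Eucl N → Eucl N, IsWeakGradient Ω u g ∧
      MemLp g (ENNReal.ofReal p) (volume.restrict Ω) ∧
      ∀ ε : ℝ≥0∞, 0 < ε → ∃ φ : Eucl N → ℝ, IsTestFunction Ω φ ∧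
        eLpNorm (fun x => u x - φ x) (ENNReal.ofReal p) (volume.restrict Ω) < ε ∧
        eLpNorm (fun x => g x - gradient φ x) (ENNReal.ofReal p) (volume.restrict Ω) < ε

/-- `u ∈ X(Ω)`: `u ∈ W^{1,p}(ℝ^N)`, its restriction to `Ω` lies in `W_0^{1,p}(Ω)`, and `u = 0`
almost everywhere outside `Ω`. -/
def MemX {N : ℕ} (Ω : Set (Eucl N)) (p : ℝ) (u : Eucl N → ℝ) : Prop :=
  MemW1p univ p u ∧ MemW1p0 Ω p u ∧ ∀ᵐ x ∂(volume.restrict Ωᶜ), u x = 0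

/-- The `p`-th power `[u]_{s,p}^p` of the Gagliardo seminorm, with values in `[0, ∞]`. -/
noncomputable def gagliardo {N : ℕ} (s p : ℝ) (u : Eucl N → ℝ) : ℝ≥0∞ :=
  ∫⁻ x : Eucl N, ∫⁻ y : Eucl N,
    ENNReal.ofReal (|u x - u y| ^ p / ‖x - y‖ ^ ((N : ℝ) + s * p))

/-- The classical Hardy constant `C_H = ((N - p) / p) ^ p`. -/
noncomputable def hardyConst (N : ℕ) (p : ℝ) : ℝ := (((N : ℝ) - p) / p) ^ p

/-- The surface measure `|𝕊^{N-2}|` of the unit sphere of `ℝ^{N-1}` (used for `N ≥ 2` only;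
for `N = 2` it is `|𝕊^0| = 2`). -/
noncomputable def sphereArea (N : ℕ) : ℝ :=
  (volume : Measure (Eucl (N - 1))).toSphere.real univ

/-- The kernel `Ψ_{N,s,p}(r)`. -/
noncomputable def Psi (N : ℕ) (s p r : ℝ) : ℝ :=
  if 2 ≤ N then
    sphereArea N * ∫ t in (-1 : ℝ)..1,
      (1 - t ^ 2) ^ (((N : ℝ) - 3) / 2) / (1 - 2 * r * t + r ^ 2) ^ (((N : ℝ) + p * s) / 2)
  else 1 / (1 - r) ^ (1 + p * s) + 1 / (1 + r) ^ (1 + p * s)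

/-- The sharp fractional Hardy constant `C_{N,p,s}`. -/
noncomputable def fracHardyConst (N : ℕ) (p s : ℝ) : ℝ :=
  2 * ∫ r in (0 : ℝ)..1,
    r ^ (p * s - 1) * |1 - r ^ (((N : ℝ) - p * s) / p)| ^ p * Psi N s p r

end MixedHardy

/-! For `x ≠ 0`, weighted AM-GM with `λ = (θ - s) / (1 - s)` gives `‖x‖ ^ (-pθ) ≤ λ ‖x‖ ^ (-p) + (1
- λ) ‖x‖ ^ (-ps)`. The theorem is therefore a convex combination of the classical Hardy inequality
on `Ω` and the fractional one on the whole space, each with its own constant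
(`MemW1p0.lintegral_hardy`, `MemX.fractional_hardy`).

Classical: a test function satisfies `φ x = -∫_1^∞ ∇φ(τ x) · x dτ`. A weighted Hölder inequality in
`τ`, followed by scaling in `x`, bounds the `L^p` norm of the ray integral with constant `p / (N -
p)`. Density and Fatou extend the bound to `W_0^{1,p}(Ω)`.

Fractional: this is a ground state argument with `w(x) = ‖x‖ ^ (-a)`, `a = (N - ps) / p`. When `‖y‖
< ‖x‖`, put `t = w(x) / w(y) < 1`. Convexity of the `p`-th power bounds `|u y|^p (1 - t)^(p-1)` by
`|u x - u y|^p` plus a multiple of `|u x|^p` depending on `t` (`ground_state_inequality`).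
Integrated against the kernel, each term containing only one value of `u` is a radial constant times
`J = ∫ |u|^p / ‖x‖^(ps)`. By the inversion symmetry of `Ψ` the two constants differ by exactly half
of `C_{N,p,s}` (`radialIntegral_outerProfile`).

Each constant may diverge at `‖y‖ = ‖x‖`, so the argument runs on `‖y‖ < c ‖x‖` with `c < 1`, and
then `c → 1`. The cancellation also needs `J < ∞`, which the classical inequality and `u ∈ L^p`
provide. -/

namespace MixedHardy

/-! ### Polar coordinates and integrals of functions of one coordinate and the norm -/

section Polar

theorem lintegral_fun_norm {E : Type*} [NormedAddCommGroup E] [NormedSpace ℝ E]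
    [MeasurableSpace E] [BorelSpace E] [FiniteDimensional ℝ E] [Nontrivial E] (μ : Measure E)
    [μ.IsAddHaarMeasure] {f : ℝ → ℝ≥0∞} (hf : Measurable f) :
    ∫⁻ x, f ‖x‖ ∂μ = μ.toSphere univ *
      ∫⁻ r in Ioi (0 : ℝ), ENNReal.ofReal (r ^ (Module.finrank ℝ E - 1)) * f r :=
  calc
    ∫⁻ x, f ‖x‖ ∂μ = ∫⁻ x : ({(0)}ᶜ : Set E), f (‖x.1‖) ∂(μ.comap (↑)) := by
      rw [lintegral_subtype_comap (measurableSet_singleton _).compl (fun x ↦ f ‖x‖),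
        restrict_compl_singleton]
    _ = ∫⁻ x, f x.2 ∂μ.toSphere.prod (.volumeIoiPow (Module.finrank ℝ E - 1)) := by
      simpa using (μ.measurePreserving_homeomorphUnitSphereProd.lintegral_comp_emb
        (Homeomorph.measurableEmbedding _) (f ∘ Subtype.val ∘ Prod.snd))
    _ = μ.toSphere univ * ∫⁻ x : Ioi (0 : ℝ), f x ∂.volumeIoiPow (Module.finrank ℝ E - 1) := by
      rw [lintegral_prod _ (by fun_prop)]
      simp [mul_comm]
    _ = _ := by
      rw [Measure.volumeIoiPow, lintegral_withDensity_eq_lintegral_mul _ (by fun_prop)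
        (by fun_prop)]
      congr 1
      exact lintegral_subtype_comap measurableSet_Ioi
        (fun r : ℝ ↦ ENNReal.ofReal (r ^ (Module.finrank ℝ E - 1)) * f r)

theorem lintegral_eucl_succ {n : ℕ} {F : ℝ → ℝ → ℝ≥0∞} (hF : Measurable (Function.uncurry F)) :
    ∫⁻ y : Eucl (n + 1), F (y 0) ‖y‖ =
      ∫⁻ t : ℝ, ∫⁻ z : Eucl n, F t (√(t ^ 2 + ‖z‖ ^ 2)) := by
  have h1 := (PiLp.volume_preserving_toLp (Fin (n + 1))).lintegral_comp_emb
    (MeasurableEquiv.toLp 2 _).measurableEmbedding (fun y : Eucl (n + 1) ↦ F (y 0) ‖y‖)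
  have h2 := (volume_preserving_piFinSuccAbove (fun _ : Fin (n + 1) => ℝ) 0).symm.lintegral_comp_emb
    (MeasurableEquiv.measurableEmbedding _)
    (fun y : Fin (n + 1) → ℝ ↦ F (y 0) ‖(WithLp.toLp 2 y : Eucl (n + 1))‖)
  have h3 : ∀ (t : ℝ) (z : Fin n → ℝ),
      ‖(WithLp.toLp 2 ((MeasurableEquiv.piFinSuccAbove (fun _ : Fin (n + 1) => ℝ) 0).symm (t, z)) :
        Eucl (n + 1))‖ = √(t ^ 2 + ‖(WithLp.toLp 2 z : Eucl n)‖ ^ 2) := by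
    intro t z
    simp [EuclideanSpace.norm_eq, Fin.sum_univ_succ, MeasurableEquiv.piFinSuccAbove,
      Real.sq_sqrt (Finset.sum_nonneg fun i _ ↦ sq_nonneg (z i))]
  rw [← h1, ← h2, Measure.volume_eq_prod, lintegral_prod]
  · refine lintegral_congr fun t ↦ ?_
    have h4 := (PiLp.volume_preserving_toLp (Fin n)).lintegral_comp_emb
      (MeasurableEquiv.toLp 2 _).measurableEmbedding (fun z : Eucl n ↦ F t (√(t ^ 2 + ‖z‖ ^ 2)))
    rw [← h4]
    refine lintegral_congr fun z ↦ ?_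
    rw [h3]
    simp [MeasurableEquiv.piFinSuccAbove]
  · refine Measurable.aemeasurable ?_
    have : (fun z : ℝ × (Fin n → ℝ) ↦ F ((MeasurableEquiv.piFinSuccAbove
        (fun _ : Fin (n + 1) => ℝ) 0).symm z 0) ‖(WithLp.toLp 2
          ((MeasurableEquiv.piFinSuccAbove (fun _ : Fin (n + 1) => ℝ) 0).symm z) : Eucl (n + 1))‖)
        = fun z ↦ Function.uncurry F (z.1, √(z.1 ^ 2 + ‖(WithLp.toLp 2 z.2 : Eucl n)‖ ^ 2)) := by
      ext ⟨t, z⟩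
      rw [h3]
      simp [MeasurableEquiv.piFinSuccAbove]
    rw [this]
    refine hF.comp ?_
    fun_prop

/-- Planar polar coordinates on the upper half plane: for `r > 0` and `φ ∈ (-π, π)`, the condition
`r sin φ > 0` selects the angles in `(0, π)`. -/
theorem lintegral_planar_polar {G : ℝ → ℝ → ℝ≥0∞} (hG : Measurable (Function.uncurry G)) :
    ∫⁻ t : ℝ, ∫⁻ τ in Ioi (0 : ℝ), G t τ =
      ∫⁻ r in Ioi (0 : ℝ), ∫⁻ φ in Ioo 0 Real.pi,
        ENNReal.ofReal r * G (r * Real.cos φ) (r * Real.sin φ) := by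
  have h := lintegral_comp_polarCoord_symm
    (fun q : ℝ × ℝ ↦ (Ioi (0 : ℝ)).indicator (fun τ ↦ G q.1 τ) q.2)
  have hm : Measurable (fun q : ℝ × ℝ ↦ (Ioi (0 : ℝ)).indicator (fun τ ↦ G q.1 τ) q.2) := by
    have : (fun q : ℝ × ℝ ↦ (Ioi (0 : ℝ)).indicator (fun τ ↦ G q.1 τ) q.2) =
        (Prod.snd ⁻¹' Ioi (0 : ℝ)).indicator (Function.uncurry G) := by
      ext q
      simp [indicator, Function.uncurry]
    rw [this]
    exact hG.indicator (measurable_snd measurableSet_Ioi)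
  rw [Measure.volume_eq_prod, lintegral_prod _ hm.aemeasurable] at h
  simp_rw [lintegral_indicator measurableSet_Ioi] at h
  rw [← h, polarCoord_target, ← Measure.prod_restrict, lintegral_prod]
  · refine setLIntegral_congr_fun measurableSet_Ioi fun r hr ↦ ?_
    have hr : 0 < r := hr
    rw [← lintegral_indicator measurableSet_Ioo, ← lintegral_indicator measurableSet_Ioo]
    refine lintegral_congr fun φ ↦ ?_
    simp only [polarCoord_symm_apply, indicator, mem_Ioo, mem_Ioi, smul_eq_mul]
    by_cases h1 : -Real.pi < φ ∧ φ < Real.pi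
    · rcases lt_or_ge 0 φ with h0 | h0
      · have hs := mul_pos hr (Real.sin_pos_of_pos_of_lt_pi h0 h1.2)
        simp [h0, h1, hs]
      · have hs : ¬ 0 < r * Real.sin φ :=
          not_lt.2 (mul_nonpos_of_nonneg_of_nonpos hr.le
            (Real.sin_nonpos_of_nonpos_of_neg_pi_le h0 h1.1.le))
        simp [hs, not_lt.2 h0]
    · have : ¬ (0 < φ ∧ φ < Real.pi) := fun h ↦ h1 ⟨by linarith [Real.pi_pos], h.2⟩
      simp [h1, this]
  · refine Measurable.aemeasurable ?_
    simp only [smul_eq_mul]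
    refine (by fun_prop : Measurable fun a : ℝ × ℝ ↦ ENNReal.ofReal a.1).mul (hm.comp ?_)
    exact continuous_polarCoord_symm.measurable

theorem lintegral_cos_sub {n : ℕ} (hn : 1 ≤ n) (f : ℝ → ℝ≥0∞) :
    ∫⁻ t in Ioo (-1 : ℝ) 1, ENNReal.ofReal ((1 - t ^ 2) ^ ((((n + 1 : ℕ) : ℝ) - 3) / 2)) * f t =
      ∫⁻ φ in Ioo 0 Real.pi, ENNReal.ofReal (Real.sin φ ^ (n - 1)) * f (Real.cos φ) := by
  have him : Real.cos '' Ioo 0 Real.pi = Ioo (-1) 1 := by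
    ext t
    constructor
    · rintro ⟨φ, hφ, rfl⟩
      have hs := Real.sin_pos_of_pos_of_lt_pi hφ.1 hφ.2
      constructor <;> nlinarith [Real.sin_sq_add_cos_sq φ]
    · rintro ⟨h1, h2⟩
      exact ⟨Real.arccos t, ⟨Real.arccos_pos.2 h2, Real.arccos_lt_pi.2 h1⟩,
        Real.cos_arccos h1.le h2.le⟩
  rw [← him, lintegral_image_eq_lintegral_abs_deriv_mul measurableSet_Ioo
    (fun φ _ ↦ (Real.hasDerivAt_cos φ).hasDerivWithinAt)
    (Real.injOn_cos.mono Ioo_subset_Icc_self)]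
  refine setLIntegral_congr_fun measurableSet_Ioo fun φ hφ ↦ ?_
  have hs := Real.sin_pos_of_pos_of_lt_pi hφ.1 hφ.2
  rw [← mul_assoc, ← ENNReal.ofReal_mul (abs_nonneg _)]
  congr 2
  have : 1 - Real.cos φ ^ 2 = Real.sin φ ^ (2 : ℝ) := by
    rw [Real.rpow_two]; linarith [Real.sin_sq_add_cos_sq φ]
  rw [abs_neg, abs_of_pos hs, this, ← Real.rpow_mul hs.le, ← Real.rpow_natCast]
  nth_rw 1 [← Real.rpow_one (Real.sin φ)]
  rw [← Real.rpow_add hs]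
  congr 1
  push_cast [hn]
  ring

/-- Split off the first coordinate, use polar coordinates in the remaining `n`, then planar polar
coordinates in (first coordinate, distance to the axis), and substitute `t = cos φ`. The Jacobians
`r` and `(r sin φ)^(n-1)` combine into `r^n` and the weight in `Ψ`. -/
theorem lintegral_axial {n : ℕ} (hn : 1 ≤ n) {F : ℝ → ℝ → ℝ≥0∞}
    (hF : Measurable (Function.uncurry F)) :
    ∫⁻ y : Eucl (n + 1), F (y 0) ‖y‖ =
      ∫⁻ r in Ioi (0 : ℝ), ENNReal.ofReal (r ^ n) *
        ((volume : Measure (Eucl n)).toSphere univ * ∫⁻ t in Ioo (-1 : ℝ) 1,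
          ENNReal.ofReal ((1 - t ^ 2) ^ ((((n + 1 : ℕ) : ℝ) - 3) / 2)) * F (r * t) r) := by
  have : Nonempty (Fin n) := ⟨⟨0, hn⟩⟩
  rw [lintegral_eucl_succ hF]
  have h1 : ∀ t : ℝ, ∫⁻ z : Eucl n, F t (√(t ^ 2 + ‖z‖ ^ 2)) =
      ∫⁻ τ in Ioi (0 : ℝ), (volume : Measure (Eucl n)).toSphere univ *
        (ENNReal.ofReal (τ ^ (n - 1)) * F t (√(t ^ 2 + τ ^ 2))) := by
    intro t
    have hm : Measurable fun τ : ℝ ↦ F t (√(t ^ 2 + τ ^ 2)) :=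
      hF.comp (by fun_prop : Measurable fun τ : ℝ ↦ (t, √(t ^ 2 + τ ^ 2)))
    rw [lintegral_fun_norm volume hm, lintegral_const_mul _ (by fun_prop)]
    simp
  simp_rw [h1]
  rw [lintegral_planar_polar (G := fun t τ ↦ (volume : Measure (Eucl n)).toSphere univ *
        (ENNReal.ofReal (τ ^ (n - 1)) * F t (√(t ^ 2 + τ ^ 2))))]
  · refine setLIntegral_congr_fun measurableSet_Ioi fun r hr ↦ ?_
    have hr : 0 < r := hr
    rw [lintegral_cos_sub hn (fun t ↦ F (r * t) r), ← lintegral_const_mul _ ?_,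
      ← lintegral_const_mul _ ?_]
    · refine setLIntegral_congr_fun measurableSet_Ioo fun φ hφ ↦ ?_
      have hs := Real.sin_pos_of_pos_of_lt_pi hφ.1 hφ.2
      have : √((r * Real.cos φ) ^ 2 + (r * Real.sin φ) ^ 2) = r := by
        rw [show (r * Real.cos φ) ^ 2 + (r * Real.sin φ) ^ 2 = r ^ 2 by
          rw [mul_pow, mul_pow, ← mul_add, Real.cos_sq_add_sin_sq, mul_one], Real.sqrt_sq hr.le]
      rw [this, mul_pow, ENNReal.ofReal_mul (by positivity)]
      have hrn : ENNReal.ofReal (r ^ n) = ENNReal.ofReal r * ENNReal.ofReal (r ^ (n - 1)) := by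
        rw [← ENNReal.ofReal_mul hr.le, ← pow_succ', Nat.sub_add_cancel hn]
      rw [hrn]
      ring
    all_goals
      have : Measurable fun φ : ℝ ↦ F (r * Real.cos φ) r :=
        hF.comp (by fun_prop : Measurable fun φ : ℝ ↦ (r * Real.cos φ, r))
      fun_prop
  · have : Measurable (fun q : ℝ × ℝ ↦ F q.1 (√(q.1 ^ 2 + q.2 ^ 2))) :=
      hF.comp (by fun_prop : Measurable fun q : ℝ × ℝ ↦ (q.1, √(q.1 ^ 2 + q.2 ^ 2)))
    unfold Function.uncurry
    fun_prop

end Polar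

/-! ### The radial kernel: reduction to a unit vector, inversion symmetry, integrability -/

section Kernel

theorem lintegral_eucl_comp_smul {N : ℕ} {c : ℝ} (hc : 0 < c) (f : Eucl N → ℝ≥0∞) :
    ∫⁻ x : Eucl N, f (c • x) = ENNReal.ofReal (c ^ (-(N : ℝ))) * ∫⁻ x, f x := by
  have h := Measure.map_addHaar_smul (volume : Measure (Eucl N)) hc.ne'
  have h2 := (Homeomorph.smulOfNeZero c hc.ne' (α := Eucl N)).measurableEmbedding.lintegral_map
    (μ := volume) f
  simp only [Homeomorph.smulOfNeZero_apply] at h2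
  rw [← h2]
  rw [h, lintegral_smul_measure, smul_eq_mul]
  congr 2
  rw [finrank_euclideanSpace_fin, abs_of_pos (by positivity), Real.rpow_neg hc.le,
    Real.rpow_natCast]

/-- The extended-valued version of the kernel `Ψ`, in dimension `n + 1` and with exponent `q`. -/
noncomputable def ePsi (n : ℕ) (q r : ℝ) : ℝ≥0∞ :=
  (volume : Measure (Eucl n)).toSphere univ * ∫⁻ t in Ioo (-1 : ℝ) 1,
    ENNReal.ofReal ((1 - t ^ 2) ^ ((((n + 1 : ℕ) : ℝ) - 3) / 2)) *
      ENNReal.ofReal ((1 - 2 * r * t + r ^ 2) ^ (-(q / 2)))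

theorem measurable_ePsi (n : ℕ) (q : ℝ) : Measurable (ePsi n q) := by
  unfold ePsi
  refine Measurable.const_mul ?_ _
  refine Measurable.lintegral_prod_right' (f := fun z : ℝ × ℝ ↦
    ENNReal.ofReal ((1 - z.2 ^ 2) ^ ((((n + 1 : ℕ) : ℝ) - 3) / 2)) *
      ENNReal.ofReal ((1 - 2 * z.1 * z.2 + z.1 ^ 2) ^ (-(q / 2)))) ?_
  fun_prop

/-- Integration of a radial profile against the kernel `ePsi`. -/
noncomputable def radialIntegral (n : ℕ) (q : ℝ) (F : ℝ → ℝ≥0∞) : ℝ≥0∞ :=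
  ∫⁻ r in Ioi (0 : ℝ), ENNReal.ofReal (r ^ n) * (F r * ePsi n q r)

theorem norm_rpow_eq_sq_rpow {a b q : ℝ} (ha : 0 ≤ a) (h : a ^ 2 = b) :
    a ^ (-q) = b ^ (-(q / 2)) := by
  rw [← h, ← Real.rpow_two, ← Real.rpow_mul ha]
  congr 1
  ring

theorem lintegral_radial_mul_kernel_single {n : ℕ} (hn : 1 ≤ n) (q : ℝ) {F : ℝ → ℝ≥0∞}
    (hF : Measurable F) :
    ∫⁻ y : Eucl (n + 1), F ‖y‖ *
      ENNReal.ofReal (‖(EuclideanSpace.single 0 1 : Eucl (n + 1)) - y‖ ^ (-q)) =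
    radialIntegral n q F := by
  have h1 : ∀ y : Eucl (n + 1), ‖(EuclideanSpace.single 0 1 : Eucl (n + 1)) - y‖ ^ (-q) =
      (1 - 2 * y 0 + ‖y‖ ^ 2) ^ (-(q / 2)) := by
    intro y
    refine norm_rpow_eq_sq_rpow (norm_nonneg _) ?_
    rw [norm_sub_sq_real]
    simp [EuclideanSpace.inner_single_left]
  simp_rw [h1]
  rw [lintegral_axial hn (F := fun t r ↦ F r *
    ENNReal.ofReal ((1 - 2 * t + r ^ 2) ^ (-(q / 2)))) (by unfold Function.uncurry; fun_prop)]
  unfold radialIntegral ePsi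
  refine lintegral_congr fun r ↦ ?_
  congr 1
  rw [mul_left_comm]
  congr 1
  rw [← lintegral_const_mul _ (by fun_prop)]
  refine lintegral_congr fun t ↦ ?_
  rw [show 2 * (r * t) = 2 * r * t by ring]
  ring

/-- Scaling by `‖x‖` and a reflection move `x` to the first basis vector, so only a power of `‖x‖`
depends on `x`. -/
theorem lintegral_radial_mul_kernel {n : ℕ} (hn : 1 ≤ n) (q : ℝ) {F : ℝ → ℝ≥0∞}
    (hF : Measurable F) {x : Eucl (n + 1)} (hx : x ≠ 0) :
    ∫⁻ y : Eucl (n + 1), F (‖y‖ / ‖x‖) * ENNReal.ofReal (‖x - y‖ ^ (-q)) =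
      ENNReal.ofReal (‖x‖ ^ (((n + 1 : ℕ) : ℝ) - q)) * radialIntegral n q F := by
  have hx0 : 0 < ‖x‖ := norm_pos_iff.2 hx
  set e : Eucl (n + 1) := EuclideanSpace.single 0 1 with he
  have hev : ‖e‖ = ‖‖x‖⁻¹ • x‖ := by
    rw [norm_smul, norm_inv, norm_norm, inv_mul_cancel₀ hx0.ne', he]; simp
  set R := (Submodule.span ℝ {e - ‖x‖⁻¹ • x})ᗮ.reflection with hR
  -- Reflecting across the hyperplane orthogonal to the difference of two vectors of equal norm
  -- exchanges them.
  have hRe : R e = ‖x‖⁻¹ • x := Submodule.reflection_sub hev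
  have h1 := lintegral_eucl_comp_smul (N := n + 1) hx0
    (fun y ↦ F (‖y‖ / ‖x‖) * ENNReal.ofReal (‖x - y‖ ^ (-q)))
  have h2 := R.measurePreserving.lintegral_comp_emb R.toHomeomorph.measurableEmbedding
    (fun y ↦ F (‖‖x‖ • y‖ / ‖x‖) * ENNReal.ofReal (‖x - ‖x‖ • y‖ ^ (-q)))
  have h3 : ∀ y, F (‖‖x‖ • R y‖ / ‖x‖) * ENNReal.ofReal (‖x - ‖x‖ • R y‖ ^ (-q)) =
      ENNReal.ofReal (‖x‖ ^ (-q)) * (F ‖y‖ * ENNReal.ofReal (‖e - y‖ ^ (-q))) := by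
    intro y
    have : x - ‖x‖ • R y = ‖x‖ • R (e - y) := by
      rw [map_sub, hRe, smul_sub, smul_smul, mul_inv_cancel₀ hx0.ne', one_smul]
    rw [this, norm_smul, norm_smul, norm_norm, LinearIsometryEquiv.norm_map,
      LinearIsometryEquiv.norm_map, mul_div_cancel_left₀ _ hx0.ne',
      Real.mul_rpow (norm_nonneg _) (norm_nonneg _), ENNReal.ofReal_mul (by positivity)]
    ring
  simp_rw [h3] at h2
  rw [← h2, lintegral_const_mul _ (by fun_prop), lintegral_radial_mul_kernel_single hn q hF] at h1
  have h4 : ENNReal.ofReal (‖x‖ ^ ((n + 1 : ℕ) : ℝ)) *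
      ENNReal.ofReal (‖x‖ ^ (-((n + 1 : ℕ) : ℝ))) = 1 := by
    rw [← ENNReal.ofReal_mul (by positivity), ← Real.rpow_add hx0]
    simp
  rw [sub_eq_add_neg, Real.rpow_add hx0, ENNReal.ofReal_mul (by positivity), mul_assoc, h1,
    ← mul_assoc, h4, one_mul]

/-- The base satisfies `1 - 2t/r + r⁻² = r⁻² (1 - 2rt + r²)`. This symmetry folds integrals over `r
> 1` back into `(0, 1)`. -/
theorem ePsi_inv {n : ℕ} (q : ℝ) {r : ℝ} (hr : 0 < r) :
    ePsi n q r⁻¹ = ENNReal.ofReal (r ^ q) * ePsi n q r := by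
  unfold ePsi
  rw [mul_left_comm, ← lintegral_const_mul (ENNReal.ofReal (r ^ q)) (by fun_prop)]
  congr 1
  refine setLIntegral_congr_fun measurableSet_Ioo fun t ht ↦ ?_
  have hb : 0 ≤ 1 - 2 * r * t + r ^ 2 := by nlinarith [sq_nonneg (r - t), ht.1, ht.2]
  have : 1 - 2 * r⁻¹ * t + r⁻¹ ^ 2 = r ^ (-2 : ℝ) * (1 - 2 * r * t + r ^ 2) := by
    rw [Real.rpow_neg hr.le, Real.rpow_two]
    field_simp
    ring
  rw [this, Real.mul_rpow (by positivity) hb, ← Real.rpow_mul hr.le,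
    ENNReal.ofReal_mul (by positivity), show (-2 : ℝ) * -(q / 2) = q by ring]
  ring

theorem lintegral_Ioi_comp_inv (f : ℝ → ℝ≥0∞) :
    ∫⁻ r in Ioi (0 : ℝ), f r =
      ∫⁻ r in Ioi (0 : ℝ), ENNReal.ofReal (r ^ (-2 : ℝ)) * f r⁻¹ := by
  have him : (fun r : ℝ ↦ r⁻¹) '' Ioi 0 = Ioi 0 := by
    ext t
    constructor
    · rintro ⟨r, hr, rfl⟩
      exact inv_pos.2 (mem_Ioi.1 hr)
    · intro ht
      exact ⟨t⁻¹, inv_pos.2 (mem_Ioi.1 ht), inv_inv t⟩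
  conv_lhs => rw [← him]
  rw [lintegral_image_eq_lintegral_abs_deriv_mul measurableSet_Ioi
    (fun r hr ↦ (hasDerivAt_inv (ne_of_gt hr)).hasDerivWithinAt)
    (inv_injective.injOn)]
  refine setLIntegral_congr_fun measurableSet_Ioi fun r hr ↦ ?_
  have hr : 0 < r := hr
  rw [abs_neg, abs_of_pos (by positivity), Real.rpow_neg hr.le, Real.rpow_two]

theorem radialIntegral_eq_inv {n : ℕ} {q : ℝ} (F : ℝ → ℝ≥0∞) :
    radialIntegral n q F = ∫⁻ r in Ioi (0 : ℝ),
      ENNReal.ofReal (r ^ (q - ((n + 1 : ℕ) : ℝ) - 1)) * (F r⁻¹ * ePsi n q r) := by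
  unfold radialIntegral
  rw [lintegral_Ioi_comp_inv]
  refine setLIntegral_congr_fun measurableSet_Ioi fun r hr ↦ ?_
  have hr : 0 < r := hr
  have : r ^ (q - ((n + 1 : ℕ) : ℝ) - 1) = r ^ (-2 : ℝ) * (r⁻¹ ^ n * r ^ q) := by
    rw [inv_pow, ← Real.rpow_natCast r n, ← Real.rpow_neg hr.le, ← Real.rpow_add hr,
      ← Real.rpow_add hr]
    congr 1
    push_cast
    ring
  rw [ePsi_inv q hr, this, ENNReal.ofReal_mul (by positivity), ENNReal.ofReal_mul (by positivity)]
  ring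

theorem lintegral_ball_norm_rpow_lt_top {n : ℕ} {a : ℝ} (ha : a < ((n + 1 : ℕ) : ℝ)) (R : ℝ) :
    ∫⁻ x in Metric.ball (0 : Eucl (n + 1)) R, ENNReal.ofReal (‖x‖ ^ (-a)) < ⊤ := by
  rcases le_or_gt R 0 with hR | hR
  · simp [Metric.ball_eq_empty.2 hR]
  have h : IntegrableOn (fun x : Eucl (n + 1) ↦ ‖x‖ ^ (-a)) (Metric.ball 0 R) := by
    rw [integrableOn_fun_norm_addHaar volume (f := fun r ↦ r ^ (-a))]
    have h1 : IntegrableOn (fun r : ℝ ↦ r ^ ((n : ℝ) - a)) (Ioo 0 R) := by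
      rw [intervalIntegral.integrableOn_Ioo_rpow_iff hR]
      push_cast at ha
      linarith
    refine h1.congr_fun (fun r hr ↦ ?_) measurableSet_Ioo
    simp only [finrank_euclideanSpace_fin, Nat.add_sub_cancel, smul_eq_mul]
    rw [sub_eq_add_neg, Real.rpow_add hr.1, Real.rpow_natCast]
  have h2 := h.2
  rw [hasFiniteIntegral_iff_ofReal (Filter.Eventually.of_forall fun x ↦ by positivity)] at h2
  exact h2

end Kernel

/-! ### The constant `C_{N,p,s}`: profile identity, finiteness, positivity, truncation -/

section Constants

/-- The exponent `(N - ps) / p` of the ground state. -/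
noncomputable def groundExp (N : ℕ) (p s : ℝ) : ℝ := ((N : ℝ) - p * s) / p

/-- The profile of the subtracted term in the ground state inequality on `‖y‖ < c ‖x‖`. -/
noncomputable def innerProfile (a p c : ℝ) : ℝ → ℝ≥0∞ :=
  (Iio c).indicator fun r ↦ ENNReal.ofReal (r ^ (-(a * (p - 1))) * (1 - r ^ a) ^ (p - 1))

/-- The profile of the main term in the ground state inequality on `‖y‖ < c ‖x‖`. -/
noncomputable def outerProfile (a p c : ℝ) : ℝ → ℝ≥0∞ :=
  (Ioi c⁻¹).indicator fun r ↦ ENNReal.ofReal ((1 - r⁻¹ ^ a) ^ (p - 1))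

/-- Half of the fractional Hardy constant, with the defining integral truncated at `c`. -/
noncomputable def truncHardyConst (n : ℕ) (p s c : ℝ) : ℝ≥0∞ :=
  ∫⁻ r in Ioo 0 c, ENNReal.ofReal (r ^ (p * s - 1) * (1 - r ^ groundExp (n + 1) p s) ^ p) *
    ePsi n (((n + 1 : ℕ) : ℝ) + p * s) r

theorem measurable_innerProfile (a p c : ℝ) : Measurable (innerProfile a p c) :=
  Measurable.indicator (by fun_prop) measurableSet_Iio

theorem measurable_outerProfile (a p c : ℝ) : Measurable (outerProfile a p c) :=
  Measurable.indicator (by fun_prop) measurableSet_Ioi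

theorem groundExp_pos {N : ℕ} {p s : ℝ} (hp : 0 < p) (h : p * s < N) : 0 < groundExp N p s :=
  div_pos (sub_pos.2 h) hp

/-- After `r ↦ r⁻¹` on the left, both densities live on `(0, c)` and are `r^(ps-1) (1 - r^a)^(p-1)`
and the same times `r^a`. Their difference is `r^(ps-1) (1 - r^a)^p`, the integrand of the Hardy
constant. It is stated as a sum to avoid subtraction in `[0, ∞]`. -/
theorem radialIntegral_outerProfile {n : ℕ} {p s c : ℝ} (hp : 1 < p)
    (h : p * s < ((n + 1 : ℕ) : ℝ)) (hc0 : 0 < c) (hc1 : c < 1) :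
    radialIntegral n (((n + 1 : ℕ) : ℝ) + p * s) (outerProfile (groundExp (n + 1) p s) p c) =
      radialIntegral n (((n + 1 : ℕ) : ℝ) + p * s) (innerProfile (groundExp (n + 1) p s) p c) +
        truncHardyConst n p s c := by
  have hm := measurable_ePsi n (((n + 1 : ℕ) : ℝ) + p * s)
  have ha := groundExp_pos (zero_lt_one.trans hp) h
  have hap : groundExp (n + 1) p s * p = ((n + 1 : ℕ) : ℝ) - p * s :=
    div_mul_cancel₀ _ (by linarith)
  set a := groundExp (n + 1) p s
  have htr : truncHardyConst n p s c = ∫⁻ r in Ioi (0 : ℝ), (Iio c).indicator (fun r ↦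
      ENNReal.ofReal (r ^ (p * s - 1) * (1 - r ^ a) ^ p) *
        ePsi n (((n + 1 : ℕ) : ℝ) + p * s) r) r := by
    rw [setLIntegral_indicator measurableSet_Iio, Iio_inter_Ioi]
    rfl
  rw [radialIntegral_eq_inv, htr, radialIntegral, ← lintegral_add_left]
  · refine setLIntegral_congr_fun measurableSet_Ioi fun r hr ↦ ?_
    have hr : 0 < r := hr
    by_cases hrc : r < c
    · have hrc' : c⁻¹ < r⁻¹ := (inv_lt_inv₀ hc0 hr).2 hrc
      have ht : 0 < 1 - r ^ a := sub_pos.2 (Real.rpow_lt_one hr.le (hrc.trans hc1) ha)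
      simp only [outerProfile, innerProfile, indicator, mem_Ioi, mem_Iio, hrc, hrc', if_true,
        inv_inv]
      rw [← mul_assoc, ← mul_assoc, ← add_mul, ← ENNReal.ofReal_mul (by positivity),
        ← ENNReal.ofReal_mul (by positivity), ← ENNReal.ofReal_add (by positivity) (by positivity)]
      congr 2
      have e1 : (1 - r ^ a) ^ p = (1 - r ^ a) ^ (p - 1) * (1 - r ^ a) := by
        rw [← Real.rpow_add_one ht.ne', sub_add_cancel]
      have e2 : r ^ n * (r ^ (-(a * (p - 1))) * (1 - r ^ a) ^ (p - 1)) =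
          r ^ (p * s - 1) * r ^ a * (1 - r ^ a) ^ (p - 1) := by
        rw [← mul_assoc, ← Real.rpow_natCast, ← Real.rpow_add hr, ← Real.rpow_add hr]
        congr 2
        push_cast at hap
        linarith
      rw [e1, e2, show ((n + 1 : ℕ) : ℝ) + p * s - ((n + 1 : ℕ) : ℝ) - 1 = p * s - 1 by ring]
      ring
    · have hrc' : ¬ c⁻¹ < r⁻¹ := fun h' ↦ hrc ((inv_lt_inv₀ hc0 hr).1 h')
      simp [outerProfile, innerProfile, indicator, hrc, hrc']
  · have := measurable_innerProfile a p c
    fun_prop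

theorem one_sub_rpow_le {a r : ℝ} (ha : 0 < a) (hr0 : 0 ≤ r) (hr1 : r ≤ 1) :
    1 - r ^ a ≤ max a 1 * (1 - r) := by
  rcases le_total 1 a with h | h
  · have := one_add_mul_self_le_rpow_one_add (s := r - 1) (by linarith) h
    rw [max_eq_left h]
    rw [add_sub_cancel] at this
    linarith
  · have := Real.rpow_le_rpow_of_exponent_ge' hr0 hr1 ha.le h
    rw [max_eq_right h]
    rw [Real.rpow_one] at this
    linarith

/-- Since `c < 1`, the region `‖y‖ < c` stays away from the pole of the kernel at the unit vector
`e`. At the origin the exponent `a (p - 1)` is below the dimension because `a p = N - ps`. -/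
theorem radialIntegral_innerProfile_lt_top {n : ℕ} (hn : 1 ≤ n) {p s c : ℝ} (hp : 1 < p)
    (hs : 0 < s) (h : p * s < ((n + 1 : ℕ) : ℝ)) (hc0 : 0 < c) (hc1 : c < 1) :
    radialIntegral n (((n + 1 : ℕ) : ℝ) + p * s) (innerProfile (groundExp (n + 1) p s) p c)
      < ⊤ := by
  have ha := groundExp_pos (zero_lt_one.trans hp) h
  have hap : groundExp (n + 1) p s * p = ((n + 1 : ℕ) : ℝ) - p * s :=
    div_mul_cancel₀ _ (by linarith)
  have hps : 0 < p * s := by positivity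
  set a := groundExp (n + 1) p s
  set q := ((n + 1 : ℕ) : ℝ) + p * s
  have hq : 0 < q := by positivity
  rw [← lintegral_radial_mul_kernel_single hn q (measurable_innerProfile a p c)]
  set e : Eucl (n + 1) := EuclideanSpace.single 0 1 with he
  have hen : ‖e‖ = 1 := by simp [he]
  have hle : ∀ y : Eucl (n + 1), innerProfile a p c ‖y‖ * ENNReal.ofReal (‖e - y‖ ^ (-q)) ≤
      (Metric.ball 0 1).indicator (fun y ↦ ENNReal.ofReal ((1 - c) ^ (-q)) *
        ENNReal.ofReal (‖y‖ ^ (-(a * (p - 1))))) y := by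
    intro y
    by_cases hy : ‖y‖ < c
    · have hyb : y ∈ Metric.ball (0 : Eucl (n + 1)) 1 := by simpa using hy.trans hc1
      have hd : 1 - c ≤ ‖e - y‖ := by
        have := norm_sub_norm_le e y
        linarith
      simp only [innerProfile, indicator, mem_Iio, hy, if_true, hyb]
      rw [mul_comm]
      have h0 : 0 ≤ ‖y‖ ^ a := by positivity
      have h1 : ‖y‖ ^ a ≤ 1 := Real.rpow_le_one (norm_nonneg _) (hy.trans hc1).le ha.le
      gcongr ?_ * ENNReal.ofReal ?_
      · exact ENNReal.ofReal_le_ofReal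
          (Real.rpow_le_rpow_of_nonpos (by linarith) hd (by linarith))
      · exact mul_le_of_le_one_right (by positivity)
          (Real.rpow_le_one (by linarith) (by linarith) (by linarith))
    · simp [innerProfile, hy]
  refine (lintegral_mono hle).trans_lt ?_
  rw [lintegral_indicator measurableSet_ball, lintegral_const_mul _ (by fun_prop)]
  refine ENNReal.mul_lt_top ENNReal.ofReal_lt_top (lintegral_ball_norm_rpow_lt_top ?_ 1)
  linarith

/-- The profile that represents `truncHardyConst n p s 1` as a kernel integral. -/
noncomputable def hardyProfile (n : ℕ) (p s : ℝ) : ℝ → ℝ≥0∞ :=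
  (Iio 1).indicator fun r ↦
    ENNReal.ofReal (r ^ (p * s - ((n + 1 : ℕ) : ℝ)) * (1 - r ^ groundExp (n + 1) p s) ^ p)

theorem measurable_hardyProfile (n : ℕ) (p s : ℝ) : Measurable (hardyProfile n p s) :=
  Measurable.indicator (by fun_prop) measurableSet_Iio

theorem truncHardyConst_one {n : ℕ} {p s : ℝ} :
    truncHardyConst n p s 1 =
      radialIntegral n (((n + 1 : ℕ) : ℝ) + p * s) (hardyProfile n p s) := by
  have htr : truncHardyConst n p s 1 = ∫⁻ r in Ioi (0 : ℝ), (Iio 1).indicator (fun r ↦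
      ENNReal.ofReal (r ^ (p * s - 1) * (1 - r ^ groundExp (n + 1) p s) ^ p) *
        ePsi n (((n + 1 : ℕ) : ℝ) + p * s) r) r := by
    rw [setLIntegral_indicator measurableSet_Iio, Iio_inter_Ioi]
    rfl
  rw [htr]
  unfold radialIntegral
  refine setLIntegral_congr_fun measurableSet_Ioi fun r hr ↦ ?_
  have hr : 0 < r := hr
  by_cases hr1 : r < 1
  · simp only [hardyProfile, indicator, mem_Iio, hr1, if_true]
    rw [← mul_assoc, ← ENNReal.ofReal_mul (by positivity), ← mul_assoc, ← Real.rpow_natCast,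
      ← Real.rpow_add hr]
    congr 5
    push_cast
    ring
  · simp [hardyProfile, hr1]

/-- Seen as an integral over the unit ball, the singularities are `‖y‖ ^ (-(N - ps))` at `0` and,
since `(1 - ‖y‖^a)^p` is at most a multiple of `‖e - y‖^p`, `‖e - y‖ ^ (-(N + ps - p))` at `e`. Both
are integrable, the second because `s < 1`. -/
theorem truncHardyConst_one_lt_top {n : ℕ} (hn : 1 ≤ n) {p s : ℝ} (hp : 1 < p) (hs : 0 < s)
    (hs1 : s < 1) (h : p * s < ((n + 1 : ℕ) : ℝ)) : truncHardyConst n p s 1 < ⊤ := by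
  have ha := groundExp_pos (zero_lt_one.trans hp) h
  have hps : 0 < p * s := by positivity
  set q := ((n + 1 : ℕ) : ℝ) + p * s with hqd
  have hq : 0 < q := by positivity
  rw [truncHardyConst_one, ← lintegral_radial_mul_kernel_single hn q
    (measurable_hardyProfile n p s)]
  set a := groundExp (n + 1) p s with had
  set e : Eucl (n + 1) := EuclideanSpace.single 0 1 with he
  have hen : ‖e‖ = 1 := by simp [he]
  set b := ((n + 1 : ℕ) : ℝ) - p * s with hb
  set K := (1 / 2 : ℝ) ^ (-b) * max a 1 ^ p with hK
  -- The first majorant serves `‖y‖ ≤ 1/2`, where the kernel is bounded; the second serves `‖y‖ >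
  -- 1/2`, where `‖y‖ ^ (-b)` is bounded.
  have hle : ∀ y : Eucl (n + 1), hardyProfile n p s ‖y‖ * ENNReal.ofReal (‖e - y‖ ^ (-q)) ≤
      (Metric.ball 0 1).indicator (fun y ↦ ENNReal.ofReal ((1 / 2 : ℝ) ^ (-q)) *
        ENNReal.ofReal (‖y‖ ^ (-b))) y +
      (Metric.ball 0 2).indicator (fun z ↦ ENNReal.ofReal K *
        ENNReal.ofReal (‖z‖ ^ (-(q - p)))) (e - y) := by
    intro y
    by_cases hy : ‖y‖ < 1
    · have hyb : y ∈ Metric.ball (0 : Eucl (n + 1)) 1 := by simpa using hy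
      have hd : 1 - ‖y‖ ≤ ‖e - y‖ := by
        have := norm_sub_norm_le e y
        linarith
      have hd0 : 0 < ‖e - y‖ := by linarith
      have hyb2 : e - y ∈ Metric.ball (0 : Eucl (n + 1)) 2 := by
        have := norm_sub_le e y
        simp only [mem_ball_zero_iff]
        linarith
      have h0 : 0 ≤ ‖y‖ ^ a := by positivity
      have h1 : ‖y‖ ^ a ≤ 1 := Real.rpow_le_one (norm_nonneg _) hy.le ha.le
      have hexp : p * s - ((n + 1 : ℕ) : ℝ) = -b := by rw [hb]; ring
      simp only [hardyProfile, indicator, mem_Iio, hy, if_true, hyb, hyb2, ← had, hexp]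
      rw [← ENNReal.ofReal_mul (mul_nonneg (by positivity) (by
          apply Real.rpow_nonneg; linarith)),
        ← ENNReal.ofReal_mul (by positivity), ← ENNReal.ofReal_mul (by positivity),
        ← ENNReal.ofReal_add (by positivity) (by positivity)]
      apply ENNReal.ofReal_le_ofReal
      rcases le_or_gt ‖y‖ (1 / 2) with hh | hh
      · refine le_add_of_le_of_nonneg ?_ (by positivity)
        rw [mul_comm ((1 / 2 : ℝ) ^ (-q))]
        have h2 : (1 - ‖y‖ ^ a) ^ p ≤ 1 :=
          Real.rpow_le_one (by linarith) (by linarith) (by linarith)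
        have h3 : ‖e - y‖ ^ (-q) ≤ (1 / 2 : ℝ) ^ (-q) :=
          Real.rpow_le_rpow_of_nonpos (by norm_num) (by linarith) (by linarith)
        exact mul_le_mul (mul_le_of_le_one_right (by positivity) h2) h3 (by positivity)
          (by positivity)
      · refine le_add_of_nonneg_of_le (by positivity) ?_
        have h2 : (1 - ‖y‖ ^ a) ^ p ≤ max a 1 ^ p * ‖e - y‖ ^ p := by
          rw [← Real.mul_rpow (by positivity) (by positivity)]
          refine Real.rpow_le_rpow (by linarith) ?_ (by linarith)
          exact (one_sub_rpow_le ha (norm_nonneg _) hy.le).trans (by gcongr)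
        have h3 : ‖y‖ ^ (-b) ≤ (1 / 2 : ℝ) ^ (-b) :=
          Real.rpow_le_rpow_of_nonpos (by norm_num) hh.le (by rw [hb]; linarith)
        have h4 : ‖e - y‖ ^ (-(q - p)) = ‖e - y‖ ^ p * ‖e - y‖ ^ (-q) := by
          rw [← Real.rpow_add hd0]
          congr 1
          ring
        rw [h4, hK]
        calc _ ≤ (1 / 2 : ℝ) ^ (-b) * (max a 1 ^ p * ‖e - y‖ ^ p) * ‖e - y‖ ^ (-q) := by
              gcongr
          _ = _ := by ring
    · simp [hardyProfile, hy]
  refine (lintegral_mono hle).trans_lt ?_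
  rw [lintegral_add_left (Measurable.indicator (by fun_prop) measurableSet_ball),
    lintegral_sub_left_eq_self, lintegral_indicator measurableSet_ball,
    lintegral_indicator measurableSet_ball, lintegral_const_mul _ (by fun_prop),
    lintegral_const_mul _ (by fun_prop)]
  refine ENNReal.add_lt_top.2
    ⟨ENNReal.mul_lt_top ENNReal.ofReal_lt_top (lintegral_ball_norm_rpow_lt_top ?_ 1),
     ENNReal.mul_lt_top ENNReal.ofReal_lt_top (lintegral_ball_norm_rpow_lt_top ?_ 2)⟩
  · linarith
  · rw [hqd]
    nlinarith

theorem truncHardyConst_one_ne_zero {n : ℕ} (hn : 1 ≤ n) {p s : ℝ} (hp : 1 < p)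
    (h : p * s < ((n + 1 : ℕ) : ℝ)) : truncHardyConst n p s 1 ≠ 0 := by
  have ha := groundExp_pos (zero_lt_one.trans hp) h
  have : Nonempty (Fin n) := ⟨⟨0, hn⟩⟩
  rw [truncHardyConst_one, ← lintegral_radial_mul_kernel_single hn _
    (measurable_hardyProfile n p s), ← setLIntegral_univ]
  intro h0
  rw [setLIntegral_univ, lintegral_eq_zero_iff (by
    have := measurable_hardyProfile n p s
    fun_prop)] at h0
  set e : Eucl (n + 1) := EuclideanSpace.single 0 1 with he
  have hen : ‖e‖ = 1 := by simp [he]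
  have h1 : volume (Metric.ball (0 : Eucl (n + 1)) 1) ≠ 0 :=
    (Metric.measure_ball_pos volume _ one_pos).ne'
  apply h1
  rw [measure_eq_zero_iff_ae_notMem]
  filter_upwards [h0, Measure.ae_ne volume (0 : Eucl (n + 1))] with y hy hy0 hyb
  have hy0 : 0 < ‖y‖ := norm_pos_iff.2 hy0
  have hy1 : ‖y‖ < 1 := by simpa using hyb
  have hd : 0 < ‖e - y‖ := by
    have := norm_sub_norm_le e y
    linarith
  have ht : 0 < 1 - ‖y‖ ^ groundExp (n + 1) p s := sub_pos.2 (Real.rpow_lt_one hy0.le hy1 ha)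
  simp only [hardyProfile, indicator, mem_Iio, hy1, if_true, Pi.zero_apply, mul_eq_zero,
    ENNReal.ofReal_eq_zero] at hy
  rcases hy with hy | hy
  · exact absurd hy (not_le.2 (by positivity))
  · exact absurd hy (not_le.2 (by positivity))

theorem ePsi_lt_top {n : ℕ} (hn : 1 ≤ n) {q r : ℝ} (hq : 0 ≤ q) (hr0 : 0 < r) (hr1 : r < 1) :
    ePsi n q r < ⊤ := by
  unfold ePsi
  refine ENNReal.mul_lt_top (measure_lt_top _ _) ?_
  rw [lintegral_cos_sub hn]
  have hle : ∀ φ ∈ Ioo 0 Real.pi, ENNReal.ofReal (Real.sin φ ^ (n - 1)) *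
      ENNReal.ofReal ((1 - 2 * r * Real.cos φ + r ^ 2) ^ (-(q / 2))) ≤
      1 * ENNReal.ofReal (((1 - r) ^ 2) ^ (-(q / 2))) := by
    intro φ hφ
    have hs := Real.sin_pos_of_pos_of_lt_pi hφ.1 hφ.2
    gcongr ?_ * ENNReal.ofReal ?_
    · exact ENNReal.ofReal_le_one.2 (pow_le_one₀ hs.le (Real.sin_le_one φ))
    · refine Real.rpow_le_rpow_of_nonpos (pow_pos (by linarith) 2) ?_ (by linarith)
      nlinarith [Real.cos_le_one φ]
  refine (setLIntegral_mono' measurableSet_Ioo hle).trans_lt ?_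
  rw [setLIntegral_const]
  exact ENNReal.mul_lt_top (by simp) (by simp)

theorem Psi_eq_toReal_ePsi {n : ℕ} (hn : 1 ≤ n) {p s r : ℝ} :
    Psi (n + 1) s p r = (ePsi n (((n + 1 : ℕ) : ℝ) + p * s) r).toReal := by
  have hN : 2 ≤ n + 1 := by omega
  have hb : ∀ t ∈ Ioo (-1 : ℝ) 1, 0 ≤ 1 - 2 * r * t + r ^ 2 := fun t ht ↦ by
    nlinarith [sq_nonneg (r - t), ht.1, ht.2]
  have hb2 : ∀ t ∈ Ioo (-1 : ℝ) 1, 0 ≤ 1 - t ^ 2 := fun t ht ↦ by nlinarith [ht.1, ht.2]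
  unfold Psi ePsi sphereArea
  rw [if_pos hN, ENNReal.toReal_mul]
  congr 1
  rw [intervalIntegral.integral_of_le (by norm_num), integral_Ioc_eq_integral_Ioo,
    integral_eq_lintegral_of_nonneg_ae]
  · congr 1
    refine setLIntegral_congr_fun measurableSet_Ioo fun t ht ↦ ?_
    have h1 := hb t ht
    have h2 := hb2 t ht
    rw [← ENNReal.ofReal_mul (by positivity), Real.rpow_neg h1, div_eq_mul_inv]
  · filter_upwards [ae_restrict_mem measurableSet_Ioo] with t ht
    have h1 := hb t ht
    have h2 := hb2 t ht
    simp only [Pi.zero_apply]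
    positivity
  · exact Measurable.aestronglyMeasurable (by fun_prop)

/-- Transfers the real integrals defining `C_{N,p,s}` to `[0, ∞]`. Finiteness of the kernel for each
`r < 1` ensures that `toReal` loses nothing. -/
theorem fracHardyConst_eq {n : ℕ} (hn : 1 ≤ n) {p s : ℝ} (hp : 1 < p) (hs : 0 < s)
    (h : p * s < ((n + 1 : ℕ) : ℝ)) :
    fracHardyConst (n + 1) p s = 2 * (truncHardyConst n p s 1).toReal := by
  have ha := groundExp_pos (zero_lt_one.trans hp) h
  have hps : 0 < p * s := by positivity
  have hm := measurable_ePsi n (((n + 1 : ℕ) : ℝ) + p * s)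
  unfold fracHardyConst
  simp_rw [Psi_eq_toReal_ePsi hn]
  congr 1
  rw [intervalIntegral.integral_of_le (by norm_num), integral_Ioc_eq_integral_Ioo,
    integral_eq_lintegral_of_nonneg_ae]
  · unfold truncHardyConst groundExp
    congr 1
    refine setLIntegral_congr_fun measurableSet_Ioo fun r hr ↦ ?_
    have hlt := ePsi_lt_top hn (q := ((n + 1 : ℕ) : ℝ) + p * s) (by positivity) hr.1 hr.2
    have ht : 0 < 1 - r ^ ((((n + 1 : ℕ) : ℝ) - p * s) / p) :=
      sub_pos.2 (Real.rpow_lt_one hr.1.le hr.2 ha)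
    have h0 := hr.1.le
    rw [ENNReal.ofReal_mul (by positivity), ENNReal.ofReal_toReal hlt.ne, abs_of_pos ht]
  · filter_upwards [ae_restrict_mem measurableSet_Ioo] with r hr
    have h0 := hr.1.le
    simp only [Pi.zero_apply]
    positivity
  · exact Measurable.aestronglyMeasurable (by fun_prop)

theorem fracHardyConst_pos {n : ℕ} (hn : 1 ≤ n) {p s : ℝ} (hp : 1 < p) (hs : 0 < s)
    (hs1 : s < 1) (h : p * s < ((n + 1 : ℕ) : ℝ)) : 0 < fracHardyConst (n + 1) p s := by
  rw [fracHardyConst_eq hn hp hs h]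
  have := ENNReal.toReal_pos (truncHardyConst_one_ne_zero hn hp h)
    (truncHardyConst_one_lt_top hn hp hs hs1 h).ne
  positivity

/-- The limit `c → 1`: continuity from below of the measure having the integrand as density, along
the increasing intervals `(0, c)`. -/
theorem truncHardyConst_one_mul_le {n : ℕ} {p s : ℝ} {J X : ℝ≥0∞} (hJ : J ≠ ⊤)
    (h : ∀ c, 0 < c → c < 1 → truncHardyConst n p s c * J ≤ X) :
    truncHardyConst n p s 1 * J ≤ X := by
  set f : ℝ → ℝ≥0∞ := fun r ↦ ENNReal.ofReal (r ^ (p * s - 1) *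
    (1 - r ^ groundExp (n + 1) p s) ^ p) * ePsi n (((n + 1 : ℕ) : ℝ) + p * s) r
  have hμ : ∀ c, truncHardyConst n p s c = (volume.withDensity f) (Ioo 0 c) := fun c ↦
    (withDensity_apply f measurableSet_Ioo).symm
  obtain ⟨v, hv, hvm, hvt⟩ := exists_seq_strictMono_tendsto' (zero_lt_one (α := ℝ))
  have hU : ⋃ k, Ioo 0 (v k) = Ioo (0 : ℝ) 1 := by
    ext r
    simp only [mem_iUnion, mem_Ioo]
    constructor
    · rintro ⟨k, h1, h2⟩
      exact ⟨h1, h2.trans (hvm k).2⟩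
    · rintro ⟨h1, h2⟩
      obtain ⟨k, hk⟩ := (hvt.eventually (lt_mem_nhds h2)).exists
      exact ⟨k, h1, hk⟩
  have ht := tendsto_measure_iUnion_atTop (μ := volume.withDensity f)
    (s := fun k ↦ Ioo 0 (v k)) (fun i j hij ↦ Ioo_subset_Ioo_right (hv.monotone hij))
  rw [hU, ← hμ] at ht
  refine le_of_tendsto (ENNReal.Tendsto.mul_const ht (Or.inr hJ)) (Filter.Eventually.of_forall ?_)
  intro k
  simp only [Function.comp]
  rw [← hμ]
  exact h _ (hvm k).1 (hvm k).2

end Constants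

/-! ### Fractional Hardy inequality via the ground state -/

section FractionalHardy

/-- Convexity of `r ↦ r^p` with weights `1 - t` and `t` at the points `|a - b| / (1 - t)` and `|a| /
t`, whose weighted mean `|a - b| + |a|` dominates `|b|`. -/
theorem ground_state_inequality {a b t p : ℝ} (hp : 1 < p) (ht0 : 0 < t) (ht1 : t < 1) :
    |b| ^ p * (1 - t) ^ (p - 1) ≤
      |a - b| ^ p + |a| ^ p * (t ^ (-(p - 1)) * (1 - t) ^ (p - 1)) := by
  have h1 : 0 < 1 - t := sub_pos.2 ht1
  have hc := (convexOn_rpow hp.le).2 (x := |a - b| / (1 - t)) (y := |a| / t)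
    (by simp only [mem_Ici]; positivity) (by simp only [mem_Ici]; positivity) h1.le ht0.le
    (by ring)
  simp only [smul_eq_mul] at hc
  rw [mul_div_cancel₀ _ h1.ne', mul_div_cancel₀ _ ht0.ne',
    Real.div_rpow (abs_nonneg _) h1.le, Real.div_rpow (abs_nonneg _) ht0.le] at hc
  have hb : |b| ^ p ≤ (|a - b| + |a|) ^ p := by
    refine Real.rpow_le_rpow (abs_nonneg _) ?_ (by linarith)
    have := abs_sub_abs_le_abs_sub b a
    rw [abs_sub_comm] at this
    linarith
  have hP := Real.rpow_pos_of_pos h1 (p - 1)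
  have e1 : (1 - t) ^ p = (1 - t) ^ (p - 1) * (1 - t) := by
    rw [← Real.rpow_add_one h1.ne', sub_add_cancel]
  have e2 : t ^ p = t ^ (p - 1) * t := by
    rw [← Real.rpow_add_one ht0.ne', sub_add_cancel]
  have hT := Real.rpow_pos_of_pos ht0 (p - 1)
  calc |b| ^ p * (1 - t) ^ (p - 1)
      ≤ ((1 - t) * (|a - b| ^ p / (1 - t) ^ p) + t * (|a| ^ p / t ^ p)) * (1 - t) ^ (p - 1) := by
        gcongr
        exact hb.trans hc
    _ = _ := by
        rw [e1, e2, Real.rpow_neg ht0.le]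
        field_simp

theorem ofReal_ground_state_inequality {E : Type*} [NormedAddCommGroup E] {x y : E}
    {ux uy a p c : ℝ} (hp : 1 < p) (ha : 0 < a) (hc0 : 0 < c) (hc1 : c < 1) (hx : x ≠ 0)
    (hy : y ≠ 0) :
    ENNReal.ofReal (|uy| ^ p) * outerProfile a p c (‖x‖ / ‖y‖) ≤
      {z : E × E | ‖z.2‖ < c * ‖z.1‖}.indicator (fun _ ↦ ENNReal.ofReal (|ux - uy| ^ p)) (x, y) +
        ENNReal.ofReal (|ux| ^ p) * innerProfile a p c (‖y‖ / ‖x‖) := by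
  have hx0 : 0 < ‖x‖ := norm_pos_iff.2 hx
  have hy0 : 0 < ‖y‖ := norm_pos_iff.2 hy
  by_cases h : ‖y‖ < c * ‖x‖
  · have h1 : ‖y‖ / ‖x‖ < c := (div_lt_iff₀ hx0).2 h
    have h2 : c⁻¹ < ‖x‖ / ‖y‖ := by
      rw [← inv_div]
      exact (inv_lt_inv₀ hc0 (by positivity)).2 h1
    have ht0 : 0 < (‖y‖ / ‖x‖) ^ a := by positivity
    have ht1 : (‖y‖ / ‖x‖) ^ a < 1 := Real.rpow_lt_one (by positivity) (h1.trans hc1) ha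
    have ht2 : 0 < 1 - (‖y‖ / ‖x‖) ^ a := sub_pos.2 ht1
    have hg := ground_state_inequality (a := ux) (b := uy) hp ht0 ht1
    simp only [outerProfile, innerProfile, indicator, mem_Ioi, mem_Iio, h1, h2, if_true, inv_div,
      mem_ofPred_eq, h]
    rw [← ENNReal.ofReal_mul (by positivity), ← ENNReal.ofReal_mul (by positivity),
      ← ENNReal.ofReal_add (by positivity) (by positivity)]
    apply ENNReal.ofReal_le_ofReal
    rwa [← Real.rpow_mul (by positivity), mul_neg] at hg
  · have h2 : ¬ c⁻¹ < ‖x‖ / ‖y‖ := by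
      rw [← inv_div, inv_lt_inv₀ hc0 (by positivity), div_lt_iff₀ hx0]
      exact h
    simp [outerProfile, h2]

/-- The integral in the fractional Hardy inequality. -/
noncomputable def weightedIntegral {N : ℕ} (p b : ℝ) (u : Eucl N → ℝ) : ℝ≥0∞ :=
  ∫⁻ x : Eucl N, ENNReal.ofReal (|u x| ^ p / ‖x‖ ^ b)

theorem lintegral_mul_radial_kernel {n : ℕ} (hn : 1 ≤ n) {p s : ℝ} {u : Eucl (n + 1) → ℝ}
    (hu : Measurable u) {F : ℝ → ℝ≥0∞} (hF : Measurable F) :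
    ∫⁻ x : Eucl (n + 1), ∫⁻ y : Eucl (n + 1), ENNReal.ofReal (|u x| ^ p) * F (‖y‖ / ‖x‖) *
      ENNReal.ofReal (‖x - y‖ ^ (-(((n + 1 : ℕ) : ℝ) + p * s))) =
    radialIntegral n (((n + 1 : ℕ) : ℝ) + p * s) F * weightedIntegral p (p * s) u := by
  unfold weightedIntegral
  rw [← lintegral_const_mul _ (by fun_prop)]
  refine lintegral_congr_ae ?_
  filter_upwards [Measure.ae_ne volume (0 : Eucl (n + 1))] with x hx
  simp_rw [mul_assoc]
  rw [lintegral_const_mul _ (by fun_prop), lintegral_radial_mul_kernel hn _ hF hx, sub_add_cancel_left,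
    Real.rpow_neg (norm_nonneg _), div_eq_mul_inv, ENNReal.ofReal_mul (by positivity)]
  ring

/-- The region `‖y‖ < c ‖x‖` and its mirror image under exchanging `x` and `y` are disjoint and
carry equal integrals, whence the factor `2`. -/
theorem two_mul_lintegral_indicator_le_gagliardo {n : ℕ} {p s c : ℝ} (hc0 : 0 < c) (hc1 : c < 1)
    {u : Eucl (n + 1) → ℝ} (hu : Measurable u) :
    2 * ∫⁻ x : Eucl (n + 1), ∫⁻ y : Eucl (n + 1),
      {z : Eucl (n + 1) × Eucl (n + 1) | ‖z.2‖ < c * ‖z.1‖}.indicator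
        (fun _ ↦ ENNReal.ofReal (|u x - u y| ^ p)) (x, y) *
        ENNReal.ofReal (‖x - y‖ ^ (-(((n + 1 : ℕ) : ℝ) + p * s))) ≤ gagliardo s p u := by
  set D := {z : Eucl (n + 1) × Eucl (n + 1) | ‖z.2‖ < c * ‖z.1‖}
  have hD : MeasurableSet D := measurableSet_lt (by fun_prop) (by fun_prop)
  set G : Eucl (n + 1) × Eucl (n + 1) → ℝ≥0∞ := fun z ↦
    D.indicator (fun z ↦ ENNReal.ofReal (|u z.1 - u z.2| ^ p) *
      ENNReal.ofReal (‖z.1 - z.2‖ ^ (-(((n + 1 : ℕ) : ℝ) + p * s)))) z with hG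
  have hGm : Measurable G := Measurable.indicator (by fun_prop) hD
  have h1 : ∀ x y, D.indicator (fun _ ↦ ENNReal.ofReal (|u x - u y| ^ p)) (x, y) *
      ENNReal.ofReal (‖x - y‖ ^ (-(((n + 1 : ℕ) : ℝ) + p * s))) = G (x, y) := by
    intro x y
    by_cases h : (x, y) ∈ D <;> simp [hG, h]
  simp_rw [h1]
  have h2 : ∫⁻ x, ∫⁻ y, G (x, y) = ∫⁻ x, ∫⁻ y, G (y, x) :=
    lintegral_lintegral_swap hGm.aemeasurable
  rw [two_mul]
  nth_rw 2 [h2]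
  rw [← lintegral_add_left (Measurable.lintegral_prod_right' hGm)]
  unfold gagliardo
  refine lintegral_mono fun x ↦ ?_
  rw [← lintegral_add_left (by fun_prop)]
  refine lintegral_mono fun y ↦ ?_
  have e1 : ENNReal.ofReal (|u x - u y| ^ p / ‖x - y‖ ^ (((n + 1 : ℕ) : ℝ) + s * p)) =
      ENNReal.ofReal (|u x - u y| ^ p) *
        ENNReal.ofReal (‖x - y‖ ^ (-(((n + 1 : ℕ) : ℝ) + p * s))) := by
    rw [← ENNReal.ofReal_mul (by positivity), Real.rpow_neg (norm_nonneg _), div_eq_mul_inv,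
      mul_comm s p]
  rw [e1]
  have e2 : ENNReal.ofReal (|u y - u x| ^ p) *
        ENNReal.ofReal (‖y - x‖ ^ (-(((n + 1 : ℕ) : ℝ) + p * s))) = ENNReal.ofReal (|u x - u y| ^ p) *
        ENNReal.ofReal (‖x - y‖ ^ (-(((n + 1 : ℕ) : ℝ) + p * s))) := by
    rw [abs_sub_comm, norm_sub_rev]
  by_cases hxy : (x, y) ∈ D
  · have hyx : (y, x) ∉ D := by
      simp only [D, mem_ofPred_eq, not_lt] at hxy ⊢
      nlinarith [norm_nonneg x, norm_nonneg y]
    simp [hG, hxy, hyx]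
  · by_cases hyx : (y, x) ∈ D
    · simp only [hG, indicator, hxy, hyx, if_true, if_false, zero_add, e2, le_refl]
    · simp [hG, hxy, hyx]

theorem fractional_hardy_of_measurable {n : ℕ} (hn : 1 ≤ n) {p s : ℝ} (hp : 1 < p) (hs : 0 < s)
    (hs1 : s < 1) (h : p * s < ((n + 1 : ℕ) : ℝ)) {u : Eucl (n + 1) → ℝ} (hu : Measurable u)
    (hJ : weightedIntegral p (p * s) u ≠ ⊤) :
    ENNReal.ofReal (fracHardyConst (n + 1) p s) * weightedIntegral p (p * s) u ≤
      gagliardo s p u := by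
  have ha := groundExp_pos (zero_lt_one.trans hp) h
  rw [fracHardyConst_eq hn hp hs h, ENNReal.ofReal_mul zero_le_two, ENNReal.ofReal_toReal
    (truncHardyConst_one_lt_top hn hp hs hs1 h).ne, ENNReal.ofReal_ofNat, mul_assoc,
    mul_comm, ← ENNReal.le_div_iff_mul_le (by simp) (by simp)]
  refine truncHardyConst_one_mul_le hJ fun c hc0 hc1 ↦ ?_
  rw [ENNReal.le_div_iff_mul_le (by simp) (by simp), mul_comm]
  refine le_trans ?_ (two_mul_lintegral_indicator_le_gagliardo hc0 hc1 hu (s := s) (p := p))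
  gcongr
  set J := weightedIntegral p (p * s) u
  have hA := radialIntegral_innerProfile_lt_top hn hp hs h hc0 hc1
  have hB := radialIntegral_outerProfile hp h hc0 hc1 (s := s)
  set a := groundExp (n + 1) p s
  have hAJ := lintegral_mul_radial_kernel hn hu (measurable_innerProfile a p c) (p := p) (s := s)
  have hBJ := lintegral_mul_radial_kernel hn hu (measurable_outerProfile a p c) (p := p) (s := s)
  have hmi := measurable_innerProfile a p c
  have hmo := measurable_outerProfile a p c
  -- The outer profile multiplies `|u y|^p`, so the roles of `x` and `y` are exchanged before
  -- comparing integrands.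
  rw [lintegral_lintegral_swap (by fun_prop), hB, add_mul,
    add_comm (radialIntegral n _ _ * _)] at hBJ
  -- Adding the finite inner term to both sides reduces the claim to the pointwise ground state
  -- inequality.
  rw [← ENNReal.add_le_add_iff_right (ENNReal.mul_lt_top hA hJ.lt_top).ne, ← hBJ, ← hAJ]
  have hD : MeasurableSet {z : Eucl (n + 1) × Eucl (n + 1) | ‖z.2‖ < c * ‖z.1‖} :=
    measurableSet_lt (by fun_prop) (by fun_prop)
  rw [← lintegral_add_right]
  · refine lintegral_mono_ae ?_
    filter_upwards [Measure.ae_ne volume (0 : Eucl (n + 1))] with x hx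
    rw [← lintegral_add_right _ (by fun_prop)]
    refine lintegral_mono_ae ?_
    filter_upwards [Measure.ae_ne volume (0 : Eucl (n + 1))] with y hy
    rw [← add_mul, norm_sub_rev y x]
    gcongr
    exact ofReal_ground_state_inequality hp ha hc0 hc1 hx hy
  · refine Measurable.lintegral_prod_right' (f := fun z : Eucl (n + 1) × Eucl (n + 1) ↦
      ENNReal.ofReal (|u z.1| ^ p) * innerProfile a p c (‖z.2‖ / ‖z.1‖) *
      ENNReal.ofReal (‖z.1 - z.2‖ ^ (-(((n + 1 : ℕ) : ℝ) + p * s)))) ?_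
    fun_prop

theorem gagliardo_congr_ae {N : ℕ} {s p : ℝ} {u v : Eucl N → ℝ} (h : u =ᵐ[volume] v) :
    gagliardo s p u = gagliardo s p v := by
  unfold gagliardo
  refine lintegral_congr_ae ?_
  filter_upwards [h] with x hx
  refine lintegral_congr_ae ?_
  filter_upwards [h] with y hy
  rw [hx, hy]

theorem fractional_hardy {n : ℕ} (hn : 1 ≤ n) {p s : ℝ} (hp : 1 < p) (hs : 0 < s)
    (hs1 : s < 1) (h : p * s < ((n + 1 : ℕ) : ℝ)) {u : Eucl (n + 1) → ℝ}
    (hu : AEMeasurable u) (hJ : weightedIntegral p (p * s) u ≠ ⊤) :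
    ENNReal.ofReal (fracHardyConst (n + 1) p s) * weightedIntegral p (p * s) u ≤
      gagliardo s p u := by
  have hw : weightedIntegral p (p * s) u = weightedIntegral p (p * s) (hu.mk u) := by
    unfold weightedIntegral
    refine lintegral_congr_ae ?_
    filter_upwards [hu.ae_eq_mk] with x hx
    rw [hx]
  rw [hw] at hJ ⊢
  rw [gagliardo_congr_ae hu.ae_eq_mk]
  exact fractional_hardy_of_measurable hn hp hs hs1 h hu.measurable_mk hJ

end FractionalHardy

/-! ### Classical Hardy inequality by integration along rays -/

section ClassicalHardy

theorem lintegral_Ioi_one_rpow {a : ℝ} (ha : a < -1) :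
    ∫⁻ τ in Ioi (1 : ℝ), ENNReal.ofReal (τ ^ a) = ENNReal.ofReal (-(a + 1)⁻¹) := by
  rw [← ofReal_integral_eq_lintegral_ofReal (integrableOn_Ioi_rpow_of_lt ha one_pos),
    integral_Ioi_rpow_of_lt ha one_pos, Real.one_rpow, neg_div, one_div]
  filter_upwards [ae_restrict_mem measurableSet_Ioi] with τ hτ
  have : 0 < τ := zero_lt_one.trans hτ
  simp only [Pi.zero_apply]
  positivity

theorem rpow_lintegral_Ioi_one_le {N p : ℝ} (hp : 1 < p) (hpN : p < N) {h : ℝ → ℝ≥0∞}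
    (hh : Measurable h) :
    (∫⁻ τ in Ioi (1 : ℝ), h τ) ^ p ≤ ENNReal.ofReal (p / (N - p)) ^ (p - 1) *
      ∫⁻ τ in Ioi (1 : ℝ), ENNReal.ofReal (τ ^ (N - N / p)) * h τ ^ p := by
  have hp0 : 0 < p := by linarith
  have hN1 : 1 < N / p := (one_lt_div hp0).2 hpN
  obtain ⟨q, hpq⟩ : ∃ q, p.HolderConjugate q := ⟨_, Real.HolderConjugate.conjExponent hp⟩
  have hq0 := hpq.symm.pos
  -- With this exponent the dual weight `τ ^ (-βq)` equals `τ ^ (-N/p)`. Scaling in `x` later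
  -- produces the same power, so its integral `p / (N - p)` enters with total exponent `(p - 1) +
  -- 1`.
  set β := (N - N / p) / p with hβ
  have hβp : β * p = N - N / p := div_mul_cancel₀ _ hp0.ne'
  have hqp : p / q = p - 1 := by
    have := hpq.inv_add_inv_eq_one
    field_simp at this ⊢
    linarith
  have hβq : β * q = N / p := by
    have h1 : p = (p - 1) * q := by rw [← hqp]; field_simp
    rw [hβ]
    field_simp
    linear_combination (-N) * h1
  have key := ENNReal.lintegral_mul_le_Lp_mul_Lq (volume.restrict (Ioi (1 : ℝ))) hpq
    (f := fun τ ↦ h τ * ENNReal.ofReal (τ ^ β)) (g := fun τ ↦ ENNReal.ofReal (τ ^ (-β)))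
    (by fun_prop) (by fun_prop)
  have e1 : ∫⁻ τ in Ioi (1 : ℝ), ((fun τ ↦ h τ * ENNReal.ofReal (τ ^ β)) *
      fun τ ↦ ENNReal.ofReal (τ ^ (-β))) τ = ∫⁻ τ in Ioi (1 : ℝ), h τ := by
    refine setLIntegral_congr_fun measurableSet_Ioi fun τ hτ ↦ ?_
    have hτ0 : 0 < τ := zero_lt_one.trans hτ
    simp only [Pi.mul_apply]
    rw [mul_assoc, ← ENNReal.ofReal_mul (by positivity), ← Real.rpow_add hτ0]
    simp
  have e2 : ∫⁻ τ in Ioi (1 : ℝ), (h τ * ENNReal.ofReal (τ ^ β)) ^ p =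
      ∫⁻ τ in Ioi (1 : ℝ), ENNReal.ofReal (τ ^ (N - N / p)) * h τ ^ p := by
    refine setLIntegral_congr_fun measurableSet_Ioi fun τ hτ ↦ ?_
    have hτ0 : 0 < τ := zero_lt_one.trans hτ
    rw [ENNReal.mul_rpow_of_nonneg _ _ hp0.le, ENNReal.ofReal_rpow_of_pos (by positivity),
      ← Real.rpow_mul hτ0.le, hβp, mul_comm]
  have e3 : ∫⁻ τ in Ioi (1 : ℝ), ENNReal.ofReal (τ ^ (-β)) ^ q =
      ENNReal.ofReal (p / (N - p)) := by
    have : ∫⁻ τ in Ioi (1 : ℝ), ENNReal.ofReal (τ ^ (-β)) ^ q =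
        ∫⁻ τ in Ioi (1 : ℝ), ENNReal.ofReal (τ ^ (-(N / p))) := by
      refine setLIntegral_congr_fun measurableSet_Ioi fun τ hτ ↦ ?_
      have hτ0 : 0 < τ := zero_lt_one.trans hτ
      rw [ENNReal.ofReal_rpow_of_pos (by positivity), ← Real.rpow_mul hτ0.le, neg_mul, hβq]
    rw [this, lintegral_Ioi_one_rpow (by linarith)]
    congr 1
    have h1 : N - p ≠ 0 := by linarith
    have h2 : -(N / p) + 1 = -((N - p) / p) := by field_simp; ring
    rw [h2, inv_neg, neg_neg, inv_div]
  rw [e1, e2, e3] at key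
  calc _ ≤ ((∫⁻ τ in Ioi (1 : ℝ), ENNReal.ofReal (τ ^ (N - N / p)) * h τ ^ p) ^ (1 / p) *
        ENNReal.ofReal (p / (N - p)) ^ (1 / q)) ^ p := by gcongr
    _ = _ := by
      rw [ENNReal.mul_rpow_of_nonneg _ _ hp0.le, ← ENNReal.rpow_mul, ← ENNReal.rpow_mul,
        one_div_mul_cancel hp0.ne', ENNReal.rpow_one, one_div_mul_eq_div, hqp, mul_comm]

/-- Minkowski's integral inequality in disguise: dilation by `τ` multiplies the `L^p` norm by `τ ^
(-N/p)`, whose integral over `(1, ∞)` is `p / (N - p)`. -/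
theorem lintegral_rpow_ray_le {N : ℕ} {p : ℝ} (hp : 1 < p) (hpN : p < N) {f : Eucl N → ℝ≥0∞}
    (hf : Measurable f) :
    ∫⁻ x, (∫⁻ τ in Ioi (1 : ℝ), f (τ • x)) ^ p ≤
      ENNReal.ofReal (p / (N - p)) ^ p * ∫⁻ x, f x ^ p := by
  have hp0 : 0 < p := by linarith
  have hN1 : 1 < N / p := (one_lt_div hp0).2 hpN
  have hm : Measurable fun z : Eucl N × ℝ ↦
      ENNReal.ofReal (z.2 ^ ((N : ℝ) - N / p)) * f (z.2 • z.1) ^ p := by fun_prop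
  calc ∫⁻ x, (∫⁻ τ in Ioi (1 : ℝ), f (τ • x)) ^ p
      ≤ ∫⁻ x, ENNReal.ofReal (p / (N - p)) ^ (p - 1) *
        ∫⁻ τ in Ioi (1 : ℝ), ENNReal.ofReal (τ ^ ((N : ℝ) - N / p)) * f (τ • x) ^ p :=
        lintegral_mono fun x ↦ rpow_lintegral_Ioi_one_le hp hpN (by fun_prop)
    _ = ENNReal.ofReal (p / (N - p)) ^ (p - 1) * ∫⁻ τ in Ioi (1 : ℝ), ∫⁻ x : Eucl N,
        ENNReal.ofReal (τ ^ ((N : ℝ) - N / p)) * f (τ • x) ^ p := by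
        rw [lintegral_const_mul _ (Measurable.lintegral_prod_right' hm),
          lintegral_lintegral_swap hm.aemeasurable]
    _ = ENNReal.ofReal (p / (N - p)) ^ (p - 1) * ∫⁻ τ in Ioi (1 : ℝ),
        ENNReal.ofReal (τ ^ (-(N / p))) * ∫⁻ x : Eucl N, f x ^ p := by
        congr 1
        refine setLIntegral_congr_fun measurableSet_Ioi fun τ hτ ↦ ?_
        have hτ0 : 0 < τ := zero_lt_one.trans hτ
        rw [lintegral_const_mul _ (by fun_prop),
          lintegral_eucl_comp_smul hτ0 (fun x ↦ f x ^ p), ← mul_assoc,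
          ← ENNReal.ofReal_mul (by positivity), ← Real.rpow_add hτ0]
        congr 3
        ring
    _ = _ := by
        have h2 : -((N : ℝ) / p) + 1 = -((N - p) / p) := by field_simp; ring
        rw [lintegral_mul_const _ (by fun_prop), lintegral_Ioi_one_rpow (by linarith), h2,
          inv_neg, neg_neg, inv_div, ← mul_assoc]
        congr 1
        have h3 : ENNReal.ofReal (p / (N - p)) ≠ 0 := by
          rw [Ne, ENNReal.ofReal_eq_zero, not_le]
          exact div_pos hp0 (by linarith)
        nth_rw 2 [← ENNReal.rpow_one (ENNReal.ofReal (p / (N - p)))]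
        rw [← ENNReal.rpow_add _ _ h3 ENNReal.ofReal_ne_top, sub_add_cancel]

theorem norm_gradient {N : ℕ} (φ : Eucl N → ℝ) (x : Eucl N) :
    ‖gradient φ x‖ = ‖fderiv ℝ φ x‖ := by
  unfold gradient
  rw [LinearIsometryEquiv.norm_map]

theorem continuous_gradient {N : ℕ} {φ : Eucl N → ℝ} (hφ : ContDiff ℝ ∞ φ) :
    Continuous (gradient φ) := by
  unfold gradient
  exact (LinearIsometryEquiv.continuous _).comp (hφ.continuous_fderiv (by simp))

theorem enorm_le_lintegral_ray {N : ℕ} {φ : Eucl N → ℝ} (hφ : ContDiff ℝ ∞ φ)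
    (hc : HasCompactSupport φ) {x : Eucl N} (hx : x ≠ 0) :
    ‖φ x‖ₑ ≤ (∫⁻ τ in Ioi (1 : ℝ), ‖gradient φ (τ • x)‖ₑ) * ‖x‖ₑ := by
  have hx0 : 0 < ‖x‖ := norm_pos_iff.2 hx
  obtain ⟨R, hR⟩ := hc.isCompact.isBounded.exists_norm_le
  -- Chosen so that `‖T • x‖ = max R 0 + 2 ‖x‖` exceeds the radius `R` of the support.
  set T : ℝ := max R 0 / ‖x‖ + 2 with hT
  have hT1 : 1 ≤ T := by
    have : 0 ≤ max R 0 / ‖x‖ := by positivity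
    linarith
  have hφT : φ (T • x) = 0 := by
    by_contra h
    have h1 := hR _ (subset_tsupport φ h)
    rw [norm_smul, Real.norm_of_nonneg (by linarith), hT, add_mul, div_mul_cancel₀ _ hx0.ne'] at h1
    linarith [le_max_left R 0]
  have hd : ∀ τ : ℝ, HasDerivAt (fun τ : ℝ ↦ φ (τ • x)) (fderiv ℝ φ (τ • x) x) τ := by
    intro τ
    have h1 : HasFDerivAt φ (fderiv ℝ φ (τ • x)) (τ • x) :=
      (hφ.differentiable (by simp) _).hasFDerivAt
    have h2 : HasDerivAt (fun τ : ℝ ↦ τ • x) x τ := by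
      simpa using (hasDerivAt_id τ).smul_const x
    exact h1.comp_hasDerivAt τ h2
  have hcont : Continuous fun τ : ℝ ↦ fderiv ℝ φ (τ • x) x :=
    ((hφ.continuous_fderiv (by simp)).comp (by fun_prop)).clm_apply continuous_const
  have hF := intervalIntegral.integral_eq_sub_of_hasDerivAt (a := 1) (b := T)
    (fun τ _ ↦ hd τ) (hcont.intervalIntegrable _ _)
  rw [hφT, one_smul, zero_sub] at hF
  rw [← enorm_neg, ← hF, intervalIntegral.integral_of_le hT1]
  refine (enorm_integral_le_lintegral_enorm _).trans ?_
  have hgc : Continuous fun τ : ℝ ↦ gradient φ (τ • x) :=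
    (continuous_gradient hφ).comp (by fun_prop)
  rw [← lintegral_mul_const _ hgc.measurable.enorm]
  refine (lintegral_mono fun τ ↦ ?_).trans (lintegral_mono_set Ioc_subset_Ioi_self)
  rw [← ofReal_norm, ← ofReal_norm, ← ofReal_norm, ← ENNReal.ofReal_mul (norm_nonneg _),
    norm_gradient]
  exact ENNReal.ofReal_le_ofReal (ContinuousLinearMap.le_opNorm _ _)

theorem hardy_of_contDiff {N : ℕ} {p : ℝ} (hp : 1 < p) (hpN : p < N) {φ : Eucl N → ℝ}
    (hφ : ContDiff ℝ ∞ φ) (hc : HasCompactSupport φ) :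
    eLpNorm (fun x ↦ φ x / ‖x‖) (ENNReal.ofReal p) volume ≤
      ENNReal.ofReal (p / (N - p)) * eLpNorm (gradient φ) (ENNReal.ofReal p) volume := by
  have hp0 : 0 < p := by linarith
  have : Nonempty (Fin N) := ⟨⟨0, by exact_mod_cast hp0.trans hpN⟩⟩
  have hpe : ENNReal.ofReal p ≠ 0 := by simpa using hp0
  rw [eLpNorm_eq_lintegral_rpow_enorm_toReal hpe ENNReal.ofReal_ne_top,
    eLpNorm_eq_lintegral_rpow_enorm_toReal hpe ENNReal.ofReal_ne_top, ENNReal.toReal_ofReal hp0.le]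
  rw [one_div, ENNReal.rpow_inv_le_iff hp0, ENNReal.mul_rpow_of_nonneg _ _ hp0.le,
    ← ENNReal.rpow_mul, inv_mul_cancel₀ hp0.ne', ENNReal.rpow_one]
  refine le_trans (lintegral_mono_ae ?_)
    (lintegral_rpow_ray_le hp hpN (continuous_gradient hφ).measurable.enorm)
  filter_upwards [Measure.ae_ne volume (0 : Eucl N)] with x hx
  gcongr
  have hx0 : ‖x‖ₑ ≠ 0 := by simpa using hx
  rw [div_eq_mul_inv, enorm_mul, enorm_inv (norm_ne_zero_iff.2 hx), enorm_norm, ← div_eq_mul_inv,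
    ENNReal.div_le_iff_le_mul (Or.inl hx0) (Or.inl enorm_ne_top)]
  exact enorm_le_lintegral_ray hφ hc hx

theorem IsTestFunction.hardy {N : ℕ} {p : ℝ} (hp : 1 < p) (hpN : p < N) {Ω : Set (Eucl N)}
    {φ : Eucl N → ℝ} (hφ : IsTestFunction Ω φ) :
    eLpNorm (fun x ↦ φ x / ‖x‖) (ENNReal.ofReal p) (volume.restrict Ω) ≤
      ENNReal.ofReal (p / (N - p)) *
        eLpNorm (gradient φ) (ENNReal.ofReal p) (volume.restrict Ω) := by
  have h1 : Function.support (gradient φ) ⊆ Ω := by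
    refine Subset.trans (fun x hx ↦ ?_) hφ.2.2
    refine support_fderiv_subset ℝ (f := φ) ?_
    rw [Function.mem_support] at hx ⊢
    rwa [← norm_ne_zero_iff, ← norm_gradient, norm_ne_zero_iff]
  rw [eLpNorm_restrict_eq_of_support_subset h1]
  exact (eLpNorm_mono_measure _ Measure.restrict_le_self).trans
    (hardy_of_contDiff hp hpN hφ.1 hφ.2.1)

/-- Uniqueness of the weak gradient: it identifies a given gradient with the one approximated in
`MemW1p0`. -/
theorem IsWeakGradient.ae_eq {N : ℕ} {Ω : Set (Eucl N)} (hΩ : IsOpen Ω) {u : Eucl N → ℝ}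
    {g g' : Eucl N → Eucl N} (hg : IsWeakGradient Ω u g) (hg' : IsWeakGradient Ω u g') :
    g =ᵐ[volume.restrict Ω] g' := by
  have hint : ∀ {f : Eucl N → Eucl N}, LocallyIntegrableOn f Ω → ∀ {φ : Eucl N → ℝ},
      IsTestFunction Ω φ → Integrable (fun x ↦ φ x • f x) := by
    intro f hf φ hφ
    have h1 : IntegrableOn (fun x ↦ φ x • f x) (tsupport φ) :=
      (hf.integrableOn_compact_subset hφ.2.2 hφ.2.1).continuousOn_smul
        hφ.1.continuous.continuousOn hφ.2.1
    refine (integrableOn_iff_integrable_of_support_subset ?_).1 h1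
    intro x hx
    refine subset_tsupport φ fun h0 ↦ hx ?_
    simp [h0]
  have hloc : LocallyIntegrableOn (fun x ↦ g x - g' x) Ω := hg.2.1.sub hg'.2.1
  have h := hΩ.ae_eq_zero_of_integral_contDiff_smul_eq_zero hloc fun φ h1 h2 h3 ↦ by
    have hφ : IsTestFunction Ω φ := ⟨h1, h2, h3⟩
    have hset : ∀ f : Eucl N → Eucl N, ∫ x in Ω, φ x • f x = ∫ x, φ x • f x := fun f ↦
      setIntegral_eq_integral_of_forall_compl_eq_zero fun x hx ↦ by
        rw [image_eq_zero_of_notMem_tsupport (fun hx' ↦ hx (h3 hx')), zero_smul]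
    have e1 := hg.2.2 φ hφ
    have e2 := hg'.2.2 φ hφ
    rw [hset] at e1 e2
    simp_rw [smul_sub]
    rw [integral_sub (hint hg.2.1 hφ) (hint hg'.2.1 hφ), sub_eq_zero]
    exact neg_injective (e1.symm.trans e2)
  filter_upwards [ae_restrict_of_ae h, ae_restrict_mem hΩ.measurableSet] with x hx hxΩ
  exact sub_eq_zero.1 (hx hxΩ)

open Filter Topology in
-- Approximating test functions converge a.e. along a subsequence; Fatou handles the left side,
-- while their gradient norms are at most `G + 1/k`.
theorem MemW1p0.hardy {N : ℕ} {p : ℝ} (hp : 1 < p) (hpN : p < N) {Ω : Set (Eucl N)}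
    (hΩ : IsOpen Ω) {u : Eucl N → ℝ} (hu : MemW1p0 Ω p u) {g : Eucl N → Eucl N}
    (hg : IsWeakGradient Ω u g) :
    eLpNorm (fun x ↦ u x / ‖x‖) (ENNReal.ofReal p) (volume.restrict Ω) ≤
      ENNReal.ofReal (p / (N - p)) * eLpNorm g (ENNReal.ofReal p) (volume.restrict Ω) := by
  have hp0 : 0 < p := by linarith
  have hp1 : 1 ≤ ENNReal.ofReal p := by
    rw [← ENNReal.ofReal_one]
    exact ENNReal.ofReal_le_ofReal hp.le
  obtain ⟨hup, g', hg', hgp, happ⟩ := hu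
  rw [eLpNorm_congr_ae (hg.ae_eq hΩ hg')]
  have hε : ∀ k : ℕ, (0 : ℝ≥0∞) < ((k : ℝ≥0∞))⁻¹ := fun k ↦
    ENNReal.inv_pos.2 (ENNReal.natCast_ne_top k)
  choose φ hφ hφu hφg using fun k : ℕ ↦ happ _ (hε k)
  have hm : TendstoInMeasure (volume.restrict Ω) φ atTop u := by
    refine tendstoInMeasure_of_tendsto_eLpNorm (p := ENNReal.ofReal p) (by simpa using hp0)
      (fun k ↦ (hφ k).1.continuous.aestronglyMeasurable) hup.1 ?_
    refine tendsto_of_tendsto_of_tendsto_of_le_of_le tendsto_const_nhds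
      ENNReal.tendsto_inv_nat_nhds_zero (fun _ ↦ zero_le) fun k ↦ ?_
    rw [eLpNorm_sub_comm]
    exact (hφu k).le
  obtain ⟨ns, hns, hae⟩ := hm.exists_seq_tendsto_ae
  have hlim : ∀ᵐ x ∂(volume.restrict Ω),
      Tendsto (fun k ↦ φ (ns k) x / ‖x‖) atTop (𝓝 (u x / ‖x‖)) := by
    filter_upwards [hae] with x hx
    exact hx.div_const _
  refine (Lp.eLpNorm_lim_le_liminf_eLpNorm (p := ENNReal.ofReal p) (fun k ↦ ?_) _ hlim).trans ?_
  · exact ((hφ (ns k)).1.continuous.measurable.div measurable_norm).aestronglyMeasurable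
  set G := eLpNorm g' (ENNReal.ofReal p) (volume.restrict Ω)
  have hbound : ∀ k, eLpNorm (fun x ↦ φ (ns k) x / ‖x‖) (ENNReal.ofReal p) (volume.restrict Ω) ≤
      ENNReal.ofReal (p / (N - p)) * (G + ((ns k : ℕ) : ℝ≥0∞)⁻¹) := by
    intro k
    refine ((hφ (ns k)).hardy hp hpN).trans ?_
    gcongr
    have hgc := (continuous_gradient (hφ (ns k)).1).aestronglyMeasurable
      (μ := volume.restrict Ω)
    have h1 : gradient (φ (ns k)) = g' - (fun x ↦ g' x - gradient (φ (ns k)) x) := by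
      ext1 x
      simp
    rw [h1]
    exact (eLpNorm_sub_le hgp.1 (hgp.1.sub hgc) hp1).trans (by gcongr; exact (hφg _).le)
  have ht : Tendsto (fun k ↦ ENNReal.ofReal (p / (N - p)) * (G + ((ns k : ℕ) : ℝ≥0∞)⁻¹)) atTop
      (𝓝 (ENNReal.ofReal (p / (N - p)) * G)) := by
    have := (ENNReal.tendsto_inv_nat_nhds_zero.comp hns.tendsto_atTop).const_add G
    rw [add_zero] at this
    exact ENNReal.Tendsto.const_mul this (Or.inr ENNReal.ofReal_ne_top)
  rw [← ht.liminf_eq]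
  exact liminf_le_liminf (Eventually.of_forall hbound)

end ClassicalHardy

/-! ### Interpolation of the weights and passage to `X(Ω)` -/

section Interpolation

theorem setLIntegral_interpolate {N : ℕ} [Nonempty (Fin N)] {Ω : Set (Eucl N)} {u : Eucl N → ℝ}
    (hu : AEMeasurable u) (p : ℝ) {a b c l : ℝ} (hl0 : 0 ≤ l) (hl1 : l ≤ 1)
    (hc : c = l * a + (1 - l) * b) :
    ∫⁻ x in Ω, ENNReal.ofReal (|u x| ^ p / ‖x‖ ^ c) ≤
      ENNReal.ofReal l * (∫⁻ x in Ω, ENNReal.ofReal (|u x| ^ p / ‖x‖ ^ a)) +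
        ENNReal.ofReal (1 - l) * ∫⁻ x in Ω, ENNReal.ofReal (|u x| ^ p / ‖x‖ ^ b) := by
  have hu' := hu.restrict (s := Ω)
  rw [← lintegral_const_mul'' _ (by fun_prop), ← lintegral_const_mul'' _ (by fun_prop),
    ← lintegral_add_left' (by fun_prop)]
  refine lintegral_mono_ae (ae_restrict_of_ae ?_)
  filter_upwards [Measure.ae_ne volume (0 : Eucl N)] with x hx
  have hx0 : 0 < ‖x‖ := norm_pos_iff.2 hx
  have h1l : 0 ≤ 1 - l := sub_nonneg.2 hl1
  rw [← ENNReal.ofReal_mul hl0, ← ENNReal.ofReal_mul h1l,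
    ← ENNReal.ofReal_add (by positivity) (by positivity)]
  apply ENNReal.ofReal_le_ofReal
  have hy := Real.geom_mean_le_arith_mean2_weighted hl0 h1l (p₁ := ‖x‖ ^ (-a))
    (p₂ := ‖x‖ ^ (-b)) (by positivity) (by positivity) (by ring)
  rw [← Real.rpow_mul hx0.le, ← Real.rpow_mul hx0.le, ← Real.rpow_add hx0,
    show -a * l + -b * (1 - l) = -c by rw [hc]; ring] at hy
  simp only [div_eq_mul_inv, ← Real.rpow_neg hx0.le]
  calc |u x| ^ p * ‖x‖ ^ (-c) ≤ |u x| ^ p * (l * ‖x‖ ^ (-a) + (1 - l) * ‖x‖ ^ (-b)) := by gcongr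
    _ = _ := by ring

theorem MemW1p0.lintegral_hardy {N : ℕ} {p : ℝ} (hp : 1 < p) (hpN : p < N) {Ω : Set (Eucl N)}
    (hΩ : IsOpen Ω) {u : Eucl N → ℝ} (hu : MemW1p0 Ω p u) {g : Eucl N → Eucl N}
    (hg : IsWeakGradient Ω u g) :
    ∫⁻ x in Ω, ENNReal.ofReal (|u x| ^ p / ‖x‖ ^ p) ≤
      ENNReal.ofReal (1 / hardyConst N p) * ∫⁻ x in Ω, ENNReal.ofReal (‖g x‖ ^ p) := by
  have hp0 : 0 < p := by linarith
  have hpe : ENNReal.ofReal p ≠ 0 := by simpa using hp0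
  have h := hu.hardy hp hpN hΩ hg
  rw [eLpNorm_eq_lintegral_rpow_enorm_toReal hpe ENNReal.ofReal_ne_top,
    eLpNorm_eq_lintegral_rpow_enorm_toReal hpe ENNReal.ofReal_ne_top, ENNReal.toReal_ofReal hp0.le,
    one_div, ENNReal.rpow_inv_le_iff hp0, ENNReal.mul_rpow_of_nonneg _ _ hp0.le,
    ← ENNReal.rpow_mul, inv_mul_cancel₀ hp0.ne', ENNReal.rpow_one] at h
  have hNp : 0 < (N : ℝ) - p := by linarith
  have hC : ENNReal.ofReal (p / (N - p)) ^ p = ENNReal.ofReal (1 / hardyConst N p) := by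
    rw [ENNReal.ofReal_rpow_of_pos (by positivity), hardyConst, one_div,
      ← Real.inv_rpow (by positivity), inv_div]
  rw [hC] at h
  convert h using 3 with x x
  · rw [← ofReal_norm, ENNReal.ofReal_rpow_of_nonneg (norm_nonneg _) hp0.le, norm_div, norm_norm,
      Real.norm_eq_abs, Real.div_rpow (abs_nonneg _) (norm_nonneg _)]
  · ext x
    rw [← ofReal_norm, ENNReal.ofReal_rpow_of_nonneg (norm_nonneg _) hp0.le]

theorem lintegral_ofReal_norm_rpow_lt_top {α E : Type*} [MeasurableSpace α]
    [NormedAddCommGroup E] {μ : Measure α} {p : ℝ} (hp : 0 < p) {f : α → E}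
    (hf : MemLp f (ENNReal.ofReal p) μ) : ∫⁻ x, ENNReal.ofReal (‖f x‖ ^ p) ∂μ < ⊤ := by
  have h := lintegral_rpow_enorm_lt_top_of_eLpNorm_lt_top (by simpa using hp)
    ENNReal.ofReal_ne_top hf.2
  rw [ENNReal.toReal_ofReal hp.le] at h
  refine lt_of_le_of_lt (le_of_eq ?_) h
  refine lintegral_congr fun x ↦ ?_
  rw [← ofReal_norm, ENNReal.ofReal_rpow_of_nonneg (norm_nonneg _) hp.le]

theorem weightedIntegral_eq_setLIntegral {N : ℕ} {p b : ℝ} (hp : 0 < p) {Ω : Set (Eucl N)}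
    (hΩ : MeasurableSet Ω) {u : Eucl N → ℝ} (hu : ∀ᵐ x ∂(volume.restrict Ωᶜ), u x = 0) :
    weightedIntegral p b u = ∫⁻ x in Ω, ENNReal.ofReal (|u x| ^ p / ‖x‖ ^ b) := by
  unfold weightedIntegral
  rw [← lintegral_add_compl _ hΩ]
  have : ∫⁻ x in Ωᶜ, ENNReal.ofReal (|u x| ^ p / ‖x‖ ^ b) = ∫⁻ _ in Ωᶜ, 0 := by
    refine lintegral_congr_ae ?_
    filter_upwards [hu] with x hx
    simp [hx, Real.zero_rpow hp.ne']
  rw [this, lintegral_zero, add_zero]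

theorem MemX.fractional_hardy {n : ℕ} (hn : 1 ≤ n) {p s : ℝ} (hp : 1 < p)
    (hpN : p < ((n + 1 : ℕ) : ℝ)) (hs : 0 < s) (hs1 : s < 1) {Ω : Set (Eucl (n + 1))}
    (hΩ : IsOpen Ω) {u : Eucl (n + 1) → ℝ} (hu : MemX Ω p u) :
    ∫⁻ x in Ω, ENNReal.ofReal (|u x| ^ p / ‖x‖ ^ (p * s)) ≤
      ENNReal.ofReal (1 / fracHardyConst (n + 1) p s) * gagliardo s p u := by
  have hp0 : 0 < p := by linarith
  have hps : p * s < ((n + 1 : ℕ) : ℝ) := (mul_lt_of_lt_one_right hp0 hs1).trans hpN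
  obtain ⟨hu1, hu0, huz⟩ := hu
  have hum : AEMeasurable u := by
    have := hu1.1.1.aemeasurable
    rwa [Measure.restrict_univ] at this
  obtain ⟨hup, g, hg, hgp, -⟩ := id hu0
  have hJ : ∫⁻ x in Ω, ENNReal.ofReal (|u x| ^ p / ‖x‖ ^ (p * s)) < ⊤ := by
    -- Finiteness comes from `ps = s · p + (1 - s) · 0`: the endpoints are the classical Hardy
    -- integral and the plain `L^p` integral.
    refine (setLIntegral_interpolate hum p (a := p) (b := 0) hs.le hs1.le (by ring)).trans_lt ?_
    refine ENNReal.add_lt_top.2 ⟨ENNReal.mul_lt_top ENNReal.ofReal_lt_top ?_,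
      ENNReal.mul_lt_top ENNReal.ofReal_lt_top ?_⟩
    · exact (hu0.lintegral_hardy hp hpN hΩ hg).trans_lt
        (ENNReal.mul_lt_top ENNReal.ofReal_lt_top (lintegral_ofReal_norm_rpow_lt_top hp0 hgp))
    · simpa using lintegral_ofReal_norm_rpow_lt_top hp0 hup
  have hC := fracHardyConst_pos hn hp hs hs1 hps
  -- Vanishing outside `Ω` turns the integral over `Ω` into one over the whole space, where the
  -- fractional inequality lives.
  rw [← weightedIntegral_eq_setLIntegral hp0 hΩ.measurableSet huz] at hJ ⊢
  rw [one_div, ENNReal.ofReal_inv_of_pos hC, mul_comm _ (gagliardo s p u), ← div_eq_mul_inv,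
    ENNReal.le_div_iff_mul_le (Or.inl (by simpa using hC)) (Or.inl ENNReal.ofReal_ne_top),
    mul_comm _ (ENNReal.ofReal _)]
  exact MixedHardy.fractional_hardy hn hp hs hs1 hps hum hJ.ne

end Interpolation

end MixedHardy

/-- The mixed interpolated Hardy inequality; `g` is the weak gradient of `u` on `Ω`, and all
integrals of nonnegative functions take values in `[0, ∞]`. -/
theorem mainTheorem1 (N : ℕ) (p s θ : ℝ) (hs0 : 0 < s) (hs1 : s < 1) (hp1 : 1 < p)
    (hpN : p < (N : ℝ)) (hθs : s ≤ θ) (hθ1 : θ ≤ 1)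
    (Ω : Set (MixedHardy.Eucl N)) (hΩ : IsOpen Ω)
    (u : MixedHardy.Eucl N → ℝ) (hu : MixedHardy.MemX Ω p u)
    (g : MixedHardy.Eucl N → MixedHardy.Eucl N) (hg : MixedHardy.IsWeakGradient Ω u g) :
    (∫⁻ x in Ω, ENNReal.ofReal (|u x| ^ p / ‖x‖ ^ (p * θ))) ≤
      ENNReal.ofReal ((θ - s) / ((1 - s) * MixedHardy.hardyConst N p)) *
          (∫⁻ x in Ω, ENNReal.ofReal (‖g x‖ ^ p)) +
        ENNReal.ofReal ((1 - θ) / ((1 - s) * MixedHardy.fracHardyConst N p s)) *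
          MixedHardy.gagliardo s p u := by
  have hN : 1 < N := by exact_mod_cast hp1.trans hpN
  obtain ⟨n, rfl⟩ : ∃ n, N = n + 1 := ⟨N - 1, by omega⟩
  have hn : 1 ≤ n := by omega
  have h1s : 0 < 1 - s := sub_pos.2 hs1
  have hum : AEMeasurable u := by
    have := hu.1.1.1.aemeasurable
    rwa [Measure.restrict_univ] at this
  -- This weight is the solution `λ` of `pθ = λ p + (1 - λ) ps`.
  have hl0 : 0 ≤ (θ - s) / (1 - s) := div_nonneg (by linarith) h1s.le
  have hl1 : (θ - s) / (1 - s) ≤ 1 := (div_le_one h1s).2 (by linarith)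
  have h1l : 1 - (θ - s) / (1 - s) = (1 - θ) / (1 - s) := by field_simp; ring
  refine (MixedHardy.setLIntegral_interpolate hum p (a := p) (b := p * s) hl0 hl1
    (by rw [h1l]; field_simp; ring)).trans ?_
  rw [h1l, ← div_div, ← div_div, div_eq_mul_one_div _ (MixedHardy.hardyConst _ _),
    div_eq_mul_one_div _ (MixedHardy.fracHardyConst _ _ _), ENNReal.ofReal_mul hl0,
    ENNReal.ofReal_mul (div_nonneg (by linarith) h1s.le), mul_assoc, mul_assoc]
  gcongr
  · exact hu.2.1.lintegral_hardy hp1 hpN hΩ hg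
  · exact hu.fractional_hardy hn hp1 hpN hs0 hs1 hΩ
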